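/- Let $\mathcal U=\mathbb Z\langle u_1,\dots,u_8\rangle$ be the free associative ring; its monomials are identified with words in the letters $1,\dots,8$, and $\langle\cdot,\cdot\rangle$ is the symmetric bilinear form for which the words are orthonormal. Let $I$ be the two-sided ideal of $\mathcal U$ generated by the elements $b(ac-ca)-(ac-ca)b$ for letters $a<b<c$ and by all words with a repeated letter, and let $I^\perp=\{f\in\mathcal U : \langle z,f\rangle=0 \text{ for all } z\in I\}$. Put $e_d(\mathbf u)=\sum_{i_1>\cdots>i_d}u_{i_1}\cdots u_{i_d}$ (with $e_0=1$, and $e_d=0$ for $d<0$), and for a partition $\lambda$ with conjugate $\lambda'=(\lambda'_1,\dots,\lambda'_t)$ let $$\mathfrak J_\lambda(\mathbf u)=\sum_{\pi\in\mathcal S_t}\operatorname{sgn}(\pi)\,e_{\lambda'_1+\pi(1)-1}(\mathbf u)\cdots e_{\lambda'_t+\pi(t)-t}(\mathbf u).$$ Let $\Delta$ be the $\mathbb Z$-linear map on $\mathcal U$ sending a word $w$ to Gessel's fundamental quasisymmetric function $Q_{\mathrm{Des}(w)}(\mathbf x)$, $\mathrm{Des}(w)=\{i: w_i>w_{i+1}\}$.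 A power series is called Schur positive if it is a finite nonnegative integer combination of Schur functions. A D$_0$ graph of degree $n$ is a graph on a set $W$ of words of length $n$ with no repeated letter, with edges coloured from $\{2,\dots,n-1\}$, such that (i) each $i$-edge is one of the pairs $\{v\,bac\,w, v\,bca\,w\}$, $\{v\,acb\,w, v\,cab\,w\}$, $\{v\,bac\,w, v\,acb\,w\}$, $\{v\,bca\,w, v\,cab\,w\}$ for some letters $a<b<c$ and words $v,w$ with $v$ of length $i-2$; and (ii) for all such $a<b<c$, $v$, $w$, each element of $W\cap\{v\,bac\,w, v\,bca\,w, v\,acb\,w, v\,cab\,w\}$ belongs to exactly one $i$-edge. Its generating function is $\sum_{w\in W}Q_{\mathrm{Des}(w)}(\mathbf x)$. For $w\in\mathcal S_8$ (written as a word) let $P(w)$ be its Schensted (row) insertion tableau, and let $\mathrm{inv}_k(w)$ be the number of pairs $i<j$ with $0<w_i-w_j<k$. For a $k$-tuple $\beta=(\beta^{(0)},\dots,\beta^{(k-1)})$ of skew shapes (drawn in the English convention, rows numbered downwards), the shifted content of the cell in row $r$ and column $s$ of $\beta^{(i)}$ is $k(s-r)+i$, and $\mathsf W_k(\beta)$ is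 the set of words with no repeated letter that are rearrangements of the shifted contents of $\beta$ and in which, whenever $z'$ is a cell of some $\beta^{(i)}$ immediately east or south of a cell $z$ of $\beta^{(i)}$, the shifted content of $z$ occurs before that of $z'$. Let $W^*\subseteq\mathcal S_8$ be the union of - $\{w\in\mathcal S_8 : P(w)\text{ has shape }(2,2,2,2)\text{ and } P(w)\text{ is not the tableau with rows }12,\,34,\,56,\,78\}$, - $\{w\in\mathcal S_8 : w\in\mathsf W_3(\beta_3),\ \mathrm{inv}_3(w)=9\}$, where $\beta_3=(33,333,333)/(22,222,222)$, - $\{w\in\mathcal S_8 : w\in\mathsf W_7(\beta_7),\ \mathrm{inv}_7(w)=18\}$, where $\beta_7=(2,2,1,1,1,1,1)/(1,\varnothing,\varnothing,\varnothing,\varnothing,\varnothing,\varnothing)$, and let $\bar W^*=\mathcal S_8\setminus W^*$ and $f^*=\sum_{w\in\bar W^*}w\in\mathcal U$. Then $f^*\in I^\perp$ and $\langle\mathfrak J_{(2,2,2,2)}(\mathbf u),f^*\rangle=-1$. The generating function $\Delta(f^*)$ is not Schur positive, and there is a D$_0$ graph with vertex set $\bar W^*$ whose generating function is not Schur positive.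 -/

import Mathlib

noncomputable section

namespace DZero

/-! ### Words and the free associative algebra

A word in the alphabet `{1, …, N}` is a list over `Fin N`; the element `a : Fin N` stands for the
letter `a + 1`. -/

/-- The words with no repeated letter, of length `n`. -/
def IsStdWord {N : ℕ} (n : ℕ) (w : List (Fin N)) : Prop := w.length = n ∧ w.Nodup

/-- The permutations of `N` in one-line notation, as words. -/
def permWords (N : ℕ) : Finset (List (Fin N)) :=
  (Finset.univ : Finset (Equiv.Perm (Fin N))).image fun σ => List.ofFn fun i => σ i

/-- The free associative ring `ℤ⟨u_1, …, u_N⟩`, with basis the words. -/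
abbrev U (N : ℕ) : Type := MonoidAlgebra ℤ (FreeMonoid (Fin N))

/-- A word, as a monomial. -/
def mono {N : ℕ} (w : List (Fin N)) : U N := MonoidAlgebra.single (FreeMonoid.ofList w) 1

/-- A single variable. -/
def var {N : ℕ} (a : Fin N) : U N := mono [a]

/-- The sum of the words in a finite set of words. -/
def wordSum {N : ℕ} (W : Finset (List (Fin N))) : U N := ∑ w ∈ W, mono w

/-- The bilinear form on `U N` for which the words are orthonormal. -/
def pairing {N : ℕ} (f g : U N) : ℤ := f.coeff.sum fun w c => c * g.coeff w

/-- The orthogonal complement of a two-sided ideal. -/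
def perp {N : ℕ} (I : TwoSidedIdeal (U N)) : Set (U N) := {f | ∀ z ∈ I, pairing z f = 0}

/-- The two-sided ideal generated by the elements `b(ac - ca) - (ac - ca)b` for letters `a < b < c`
and by the words with a repeated letter. -/
def idealKR (N : ℕ) : TwoSidedIdeal (U N) :=
  TwoSidedIdeal.span
    ({z | ∃ a b c : Fin N, a < b ∧ b < c ∧
        z = var b * (var a * var c - var c * var a) - (var a * var c - var c * var a) * var b} ∪
      {z | ∃ w : List (Fin N), ¬ w.Nodup ∧ z = mono w})

/-! ### Noncommutative elementary symmetric and Schur functions -/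

/-- The noncommutative elementary symmetric function: the sum of all strictly decreasing words of
length `d`; it is `0` for `d < 0` (and `1` for `d = 0`). -/
def ncElem (N : ℕ) (d : ℤ) : U N :=
  if d < 0 then 0
  else ∑ S ∈ (Finset.univ : Finset (Fin N)).powersetCard d.toNat, mono (S.sort (· ≥ ·))

/-- The noncommutative Schur function, by the Jacobi–Trudi formula in the column lengths of `μ`
(the product is taken from left to right). -/
def ncSchur (N : ℕ) (μ : YoungDiagram) : U N :=
  ∑ π : Equiv.Perm (Fin (μ.rowLen 0)),
    (Equiv.Perm.sign π : ℤ) •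
      (List.ofFn fun i : Fin (μ.rowLen 0) =>
        ncElem N ((μ.colLen i : ℤ) + ((π i : ℕ) : ℤ) - ((i : ℕ) : ℤ))).prod

/-! ### Generating functions

Formal power series over `ℤ` in variables indexed by `ℕ`. -/

/-- The descents of a word, with positions counted from `0`. -/
def descents {N : ℕ} (w : List (Fin N)) : Set ℕ :=
  {j | ∃ h : j + 1 < w.length, w[j + 1] < w[j]}

/-- Gessel's fundamental quasisymmetric function of degree `n`: the sum of the monomials
`x_{s 0} ⋯ x_{s (n-1)}` over the weakly increasing `s` that increase strictly at `D`. -/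
def fundQuasi (n : ℕ) (D : Set ℕ) : MvPowerSeries ℕ ℤ := fun m =>
  (Nat.card {s : Fin n → ℕ // Monotone s ∧
    (∀ (j : ℕ) (h : j + 1 < n), j ∈ D → s ⟨j, Nat.lt_of_succ_lt h⟩ < s ⟨j + 1, h⟩) ∧
    ∑ j, Finsupp.single (s j) 1 = m} : ℤ)

/-- The linear map sending a word to the fundamental quasisymmetric function of its descent set. -/
def Delta (N : ℕ) : U N →ₗ[ℤ] MvPowerSeries ℕ ℤ :=
  (Finsupp.linearCombination ℤ fun w : FreeMonoid (Fin N) =>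
      fundQuasi w.toList.length (descents w.toList)) ∘ₗ
    (MonoidAlgebra.coeffLinearEquiv ℤ).toLinearMap

/-- The Schur function `s_μ`, the generating function of semistandard tableaux of shape `μ`. -/
def schur (μ : YoungDiagram) : MvPowerSeries ℕ ℤ := fun m =>
  (Nat.card {T : SemistandardYoungTableau μ //
    ∑ z ∈ μ.cells, Finsupp.single (T z.1 z.2) 1 = m} : ℤ)

/-- A nonnegative integer combination of Schur functions. -/
def SchurPositive (F : MvPowerSeries ℕ ℤ) : Prop :=
  ∃ c : YoungDiagram →₀ ℕ, F = c.sum fun μ k => (k : ℤ) • schur μ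

/-! ### D₀ graphs -/

/-- `{x, y}` is one of the four pairs `{v bac w, v bca w}`, `{v acb w, v cab w}` (Knuth),
`{v bac w, v acb w}`, `{v bca w, v cab w}` (rotation), in this order of `x` and `y`, for given
letters `a, b, c` and words `v, w`. -/
def IsKRPair {N : ℕ} (v w : List (Fin N)) (a b c : Fin N) (x y : List (Fin N)) : Prop :=
  (x = v ++ [b, a, c] ++ w ∧ y = v ++ [b, c, a] ++ w) ∨
  (x = v ++ [a, c, b] ++ w ∧ y = v ++ [c, a, b] ++ w) ∨
  (x = v ++ [b, a, c] ++ w ∧ y = v ++ [a, c, b] ++ w) ∨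
  (x = v ++ [b, c, a] ++ w ∧ y = v ++ [c, a, b] ++ w)

/-- The set `{v bac w, v bca w, v acb w, v cab w}`. -/
def krSquare {N : ℕ} (v w : List (Fin N)) (a b c : Fin N) : Set (List (Fin N)) :=
  {v ++ [b, a, c] ++ w, v ++ [b, c, a] ++ w, v ++ [a, c, b] ++ w, v ++ [c, a, b] ++ w}

/-- A D₀ graph of degree `n` on words in the alphabet `{1, …, N}`. The `i`-edges are the edges of
the graph `edge i` (a pair of words may be an edge of several colours). -/
structure D0Graph (N n : ℕ) where
  /-- The vertex set. -/
  verts : Finset (List (Fin N))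
  verts_std : ∀ w ∈ verts, IsStdWord n w
  /-- The edges of each colour. -/
  edge : ℕ → SimpleGraph (List (Fin N))
  edge_mem : ∀ i x y, (edge i).Adj x y → x ∈ verts ∧ y ∈ verts
  edge_color : ∀ i x y, (edge i).Adj x y → 2 ≤ i ∧ i ≤ n - 1
  edge_type : ∀ i x y, (edge i).Adj x y →
    ∃ (v w : List (Fin N)) (a b c : Fin N), v.length + 2 = i ∧ a < b ∧ b < c ∧
      (IsKRPair v w a b c x y ∨ IsKRPair v w a b c y x)
  edge_unique : ∀ (v w : List (Fin N)) (a b c : Fin N), a < b → b < c →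
    ∀ x ∈ verts, x ∈ krSquare v w a b c → ∃! y, (edge (v.length + 2)).Adj x y

/-- The generating function of a D₀ graph. -/
def D0Graph.genFun {N n : ℕ} (G : D0Graph N n) : MvPowerSeries ℕ ℤ :=
  ∑ w ∈ G.verts, fundQuasi n (descents w)

/-! ### Insertion tableaux -/

/-- Row insertion of `x` into a row: `x` replaces the leftmost entry that is larger than `x`, which
is bumped out, or is added at the end of the row if there is no such entry. -/
def rowInsert {N : ℕ} (x : Fin N) : List (Fin N) → List (Fin N) × Option (Fin N)
  | [] => ([x], none)
  | y :: r => if x < y then (x :: r, some y) else (y :: (rowInsert x r).1, (rowInsert x r).2)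

/-- Schensted insertion of `x` into a tableau given by the list of its rows. -/
def tabInsert {N : ℕ} (x : Fin N) : List (List (Fin N)) → List (List (Fin N))
  | [] => [[x]]
  | r :: T =>
    match rowInsert x r with
    | (r', none) => r' :: T
    | (r', some y) => r' :: tabInsert y T

/-- The insertion tableau `P(w)`, as the list of its rows. -/
def insTab {N : ℕ} (w : List (Fin N)) : List (List (Fin N)) :=
  w.foldl (fun T x => tabInsert x T) []

/-! ### LLT equivalence classes -/

/-- A skew shape `outer / inner`. -/
structure SkewShape where
  outer : YoungDiagram
  inner : YoungDiagram
  inner_le : inner ≤ outer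

/-- The cells `(row, column)` of a skew shape (matrix convention, counted from `0`). -/
def SkewShape.cells (s : SkewShape) : Finset (ℕ × ℕ) := s.outer.cells \ s.inner.cells

/-- The shifted content `k (column - row) + i` of a cell of the `i`-th shape in a `k`-tuple. -/
def shiftedContent (k i : ℕ) (z : ℕ × ℕ) : ℤ := k * ((z.2 : ℤ) - z.1) + i

/-- The integer represented by a letter. -/
def letterVal {N : ℕ} (a : Fin N) : ℤ := (a : ℕ) + 1

/-- The integer `p` occurs before the integer `q` in the word `v`. -/
def OccursBefore {N : ℕ} (v : List (Fin N)) (p q : ℤ) : Prop :=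
  ∃ i j : Fin v.length, i < j ∧ letterVal v[i] = p ∧ letterVal v[j] = q

/-- The words with no repeated letter that are rearrangements of the shifted contents of the tuple
`β`, and in which the shifted content of a cell occurs before that of the cell of the same shape
immediately east or immediately south of it. -/
def lltWords (N : ℕ) {k : ℕ} (β : Fin k → SkewShape) : Set (List (Fin N)) :=
  {v | v.Nodup ∧
    (v : Multiset (Fin N)).map letterVal =
      ∑ i : Fin k, (β i).cells.val.map (shiftedContent k i) ∧
    ∀ (i : Fin k), ∀ z ∈ (β i).cells, ∀ z' ∈ (β i).cells,
      (z' = (z.1, z.2 + 1) ∨ z' = (z.1 + 1, z.2)) →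
        OccursBefore v (shiftedContent k i z) (shiftedContent k i z')}

/-- The `k`-inversion number: the number of pairs of positions `i < j` with `0 < v_i - v_j < k`. -/
def kInv {N : ℕ} (k : ℕ) (v : List (Fin N)) : ℕ :=
  (Finset.univ.filter fun p : Fin v.length × Fin v.length =>
    p.1 < p.2 ∧ 0 < letterVal v[p.1] - letterVal v[p.2] ∧
      letterVal v[p.1] - letterVal v[p.2] < k).card

/-! ### The set `W̄*` -/

/-- The partition `(2,2,2,2)`. -/
def shape2222 : YoungDiagram := YoungDiagram.ofRowLens [2, 2, 2, 2] (by decide)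

/-- The skew shape `l / m` of two partitions given by the lists of their parts. -/
def skewOf (l m : List ℕ) (hl : l.SortedGE) (hm : m.SortedGE)
    (h : (YoungDiagram.ofRowLens m hm).cells ⊆ (YoungDiagram.ofRowLens l hl).cells) : SkewShape :=
  ⟨YoungDiagram.ofRowLens l hl, YoungDiagram.ofRowLens m hm, h⟩

/-- `(33, 333, 333) / (22, 222, 222)`. -/
def beta3 : Fin 3 → SkewShape :=
  ![skewOf [3, 3] [2, 2] (by decide) (by decide) (by decide),
    skewOf [3, 3, 3] [2, 2, 2] (by decide) (by decide) (by decide),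
    skewOf [3, 3, 3] [2, 2, 2] (by decide) (by decide) (by decide)]

/-- `(2, 2, 1, 1, 1, 1, 1) / (1, ∅, ∅, ∅, ∅, ∅, ∅)`. -/
def beta7 : Fin 7 → SkewShape :=
  ![skewOf [2] [1] (by decide) (by decide) (by decide),
    skewOf [2] [] (by decide) (by decide) (by decide),
    skewOf [1] [] (by decide) (by decide) (by decide),
    skewOf [1] [] (by decide) (by decide) (by decide),
    skewOf [1] [] (by decide) (by decide) (by decide),
    skewOf [1] [] (by decide) (by decide) (by decide),
    skewOf [1] [] (by decide) (by decide) (by decide)]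

open Classical in
/-- The union of the 13 Knuth classes of shape `(2,2,2,2)` in `S_8` whose insertion tableau is not
the one with rows `12, 34, 56, 78`. -/
def knuthPart : Finset (List (Fin 8)) :=
  (permWords 8).filter fun w =>
    (insTab w).map List.length = [2, 2, 2, 2] ∧ insTab w ≠ [[0, 1], [2, 3], [4, 5], [6, 7]]

open Classical in
/-- The LLT equivalence class for `k = 3`. -/
def lltPart3 : Finset (List (Fin 8)) :=
  (permWords 8).filter fun w => w ∈ lltWords 8 beta3 ∧ kInv 3 w = 9

open Classical in
/-- The LLT equivalence class for `k = 7`. -/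
def lltPart7 : Finset (List (Fin 8)) :=
  (permWords 8).filter fun w => w ∈ lltWords 8 beta7 ∧ kInv 7 w = 18

/-- The set `W*`. -/
def Wstar : Finset (List (Fin 8)) := knuthPart ∪ lltPart3 ∪ lltPart7

/-- The set `W̄*`, the complement of `W*` in `S_8`. -/
def Wbar : Finset (List (Fin 8)) := permWords 8 \ Wstar

/-- The element `f*`, the sum of the words in `W̄*`. -/
def fstar : U 8 := wordSum Wbar

end DZero

end

noncomputable section

namespace DZero

/-! ### Counting words with a partial state machine

The functions on words of natural numbers are given by recursors so that the kernel evaluates them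
fast. -/

/-! Call a set of words balanced if in every square {bac, bca, acb, cab}, in any fixed context, it
has as many words among bac, cab as among bca, acb. For a set of words without repeated letters this
gives orthogonality to the ideal, because b(ac - ca) - (ac - ca)b = bac - bca - acb + cab. Balance
also yields a D₀ graph. The Knuth and rotation pairs are the sides of a 4-cycle on the square with
bac, cab at opposite corners, so a balanced set meets the square in nothing, in the two ends of a
side, or in all four words. In the last case the two Knuth pairs give a perfect matching.

The whole of `S_8` is balanced. The three parts of `W*` are pairwise disjoint and each of them is
balanced, so the complement is balanced too. Disjointness and balance of the parts are finite
checks, done by a search in which a machine discards prefixes that cannot be completed to a member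
(`countAcc_knuth`, `countAcc_3`, `countAcc_7`).

The Jacobi–Trudi determinant for (2,2,2,2) is e_4 e_4 - e_5 e_3. Its pairing with a sum of
permutation words in `S_8` is the number of words that decrease except perhaps after the fourth
letter, minus the number of those that decrease except perhaps after the fifth. For the complement
of `W*` this is 51 - 52 = -1.

The same difference depends only on descent sets, so it extends to a linear functional `pairing2222`
on power series. A Schur function is the sum of fundamental quasisymmetric functions over standard
tableaux (`schur_eq_sum`), and a shape has at most one tableau of the second kind, which can be
modified to one of the first kind. The functional is therefore nonnegative on Schur functions
(`pairing2222_schur`), whereas its value on the generating function is -1. -/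

/-- `k n`, arranged so that the kernel evaluates `n` before it applies `k`. -/
def forceNat {β : Type} (n : ℕ) (k : ℕ → β) : β :=
  Nat.rec (k Nat.zero) (fun m _ => k (Nat.succ m)) n

/-- `k l`, evaluating the list `l` first. -/
def forceList {β : Type} (l : List ℕ) : (List ℕ → β) → β :=
  List.rec (fun k => k []) (fun x _ ih k => forceNat x fun x' => ih fun l' => k (x' :: l')) l

/-- `k T`, evaluating the list of lists `T` first. -/
def forceTab {β : Type} (T : List (List ℕ)) : (List (List ℕ) → β) → β :=
  List.rec (fun k => k []) (fun r _ ih k => forceList r fun r' => ih fun T' => k (r' :: T')) T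

theorem forceNat_eq {β : Type} (n : ℕ) (k : ℕ → β) : forceNat n k = k n := by
  cases n <;> rfl

theorem forceList_eq {β : Type} (l : List ℕ) (k : List ℕ → β) : forceList l k = k l := by
  induction l generalizing k with
  | nil => rfl
  | cons x l ih => exact (forceNat_eq x fun x' => forceList l fun l' => k (x' :: l')).trans (ih _)

theorem forceTab_eq {β : Type} (T : List (List ℕ)) (k : List (List ℕ) → β) :
    forceTab T k = k T := by
  induction T generalizing k with
  | nil => rfl
  | cons r T ih => exact (forceList_eq r fun r' => forceTab T fun T' => k (r' :: T')).trans (ih _)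

/-- The sum of `f x l` over the ways of removing one entry `x` from a list and leaving `l`. -/
def sumRemove (l : List ℕ) : (ℕ → List ℕ → ℕ) → ℕ :=
  List.rec (fun _ => Nat.zero)
    (fun x l ih f => Nat.add (f x l) (ih fun y m => f y (x :: m))) l

theorem sumRemove_eq (l : List ℕ) (hl : l.Nodup) (f : ℕ → List ℕ → ℕ) :
    sumRemove l f = ∑ x ∈ l.toFinset, f x (l.erase x) := by
  induction l generalizing f with
  | nil => rfl
  | cons x l ih =>
    have hx := List.nodup_cons.1 hl
    rw [List.toFinset_cons, Finset.sum_insert (by simpa using hx.1), List.erase_cons_head]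
    refine congrArg (f x l + ·) ((ih hx.2 _).trans (Finset.sum_congr rfl fun y hy => ?_))
    rw [List.erase_cons_tail]
    simpa using fun h : x = y => hx.1 (h ▸ List.mem_toFinset.1 hy)

/-- A partial state machine reading a word. -/
abbrev Machine : Type := List (List ℕ) → ℕ → Option (List (List ℕ))

/-- Run a partial state machine on a word. -/
def run (step : Machine) (w : List ℕ) : List (List ℕ) → Option (List (List ℕ)) :=
  List.rec (fun s => some s)
    (fun x _ ih s => Option.rec none (fun s' => forceTab s' ih) (step s x)) w

@[simp] theorem run_nil (step : Machine) (s : List (List ℕ)) : run step [] s = some s := rfl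

theorem run_cons (step : Machine) (x : ℕ) (w : List ℕ) (s : List (List ℕ)) :
    run step (x :: w) s = (step s x).bind (run step w) := by
  show (Option.rec none (fun s' => forceTab s' (run step w)) (step s x) :
    Option (List (List ℕ))) = _
  cases h : step s x with
  | none => rfl
  | some s' => exact forceTab_eq _ _

/-- The number of rearrangements of a list of length `n` that a partial state machine accepts and
whose reverses, put before `pre`, pass a test. -/
def countAcc (step : Machine) (test : List ℕ → Bool) (n : ℕ) :
    List ℕ → List (List ℕ) → List ℕ → ℕ :=
  Nat.rec (fun _ _ pre => Bool.rec Nat.zero (Nat.succ Nat.zero) (test pre))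
    (fun _ ih l s pre => sumRemove l fun x m =>
      Option.rec Nat.zero
        (fun s' => forceTab s' fun s' => forceList m fun m' => ih m' s' (x :: pre)) (step s x)) n

theorem countAcc_succ (step : Machine) (test : List ℕ → Bool) (n : ℕ) (l : List ℕ)
    (s : List (List ℕ)) (pre : List ℕ) :
    countAcc step test (n + 1) l s pre = sumRemove l fun x m =>
      (step s x).elim 0 fun s' => countAcc step test n m s' (x :: pre) := by
  show sumRemove l (fun x m => Option.rec Nat.zero (fun s' => forceTab s' fun s' =>
    forceList m fun m' => countAcc step test n m' s' (x :: pre)) (step s x)) = _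
  congr 1
  funext x m
  cases step s x with
  | none => rfl
  | some s' => exact (forceTab_eq _ _).trans (forceList_eq _ _)

/-- Rearrangements are sorted by their first letter `x`: deleting it leaves a rearrangement of
`l.erase x`, read from the state reached after `x`. If the machine stops at `x`, no word with that
beginning counts. -/
theorem card_filter_run (step : Machine) (test : List ℕ → Bool) (n : ℕ) (l : List ℕ)
    (s : List (List ℕ)) (pre : List ℕ) (hl : l.Nodup) (hn : l.length = n) :
    (l.permutations.toFinset.filter fun w =>
      (run step w s).isSome ∧ test (w.reverse ++ pre)).card = countAcc step test n l s pre := by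
  induction n generalizing l s pre with
  | zero =>
    obtain rfl : l = [] := List.length_eq_zero_iff.1 hn
    show _ = (Bool.rec Nat.zero (Nat.succ Nat.zero) (test pre) : ℕ)
    cases h : test pre <;> simp [Finset.filter_singleton, h]
  | succ n ih =>
    rw [countAcc_succ, sumRemove_eq l hl]
    have key : ∀ x ∈ l, ((l.permutations.toFinset.filter fun w =>
        (run step w s).isSome ∧ test (w.reverse ++ pre)).filter fun w => w.head? = some x).card =
        (step s x).elim 0 fun s' => countAcc step test n (l.erase x) s' (x :: pre) := by
      intro x hx
      have hlen : (l.erase x).length = n := by rw [List.length_erase_of_mem hx, hn]; rfl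
      cases hs : step s x with
      | none =>
        rw [Option.elim_none, Finset.card_eq_zero, Finset.filter_eq_empty_iff]
        intro w hw hwx
        obtain ⟨w', rfl⟩ : ∃ w', w = x :: w' := by
          cases w with
          | nil => simp at hwx
          | cons y w' => exact ⟨w', by simpa using hwx⟩
        simp [run_cons, hs] at hw
      | some s' =>
        rw [Option.elim_some, ← ih (l.erase x) s' (x :: pre) (hl.erase x) hlen]
        symm
        refine Finset.card_bij (fun w _ => x :: w) ?_ (by simp) ?_
        · intro w hw
          simp only [Finset.mem_filter, List.mem_toFinset, List.mem_permutations] at hw ⊢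
          refine ⟨⟨(hw.1.cons x).trans (List.perm_cons_erase hx).symm, ?_, ?_⟩, by simp⟩
          · simpa [run_cons, hs] using hw.2.1
          · simpa using hw.2.2
        · intro w hw
          simp only [Finset.mem_filter, List.mem_toFinset, List.mem_permutations] at hw
          obtain ⟨⟨hp, hr, ht⟩, hwx⟩ := hw
          obtain ⟨w', rfl⟩ : ∃ w', w = x :: w' := by
            cases w with
            | nil => simp at hwx
            | cons y w' => exact ⟨w', by simpa using hwx⟩
          refine ⟨w', ?_, rfl⟩
          simp only [Finset.mem_filter, List.mem_toFinset, List.mem_permutations]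
          refine ⟨(hp.trans (List.perm_cons_erase hx)).cons_inv, ?_, ?_⟩
          · simpa [run_cons, hs] using hr
          · simpa using ht
    rw [← Finset.sum_congr rfl fun x hx => key x (List.mem_toFinset.1 hx),
      ← Finset.card_biUnion]
    · congr 1
      ext w
      simp only [Finset.mem_biUnion, Finset.mem_filter, List.mem_toFinset, List.mem_permutations]
      constructor
      · rintro ⟨hp, hw⟩
        cases w with
        | nil => simp [← hp.length_eq] at hn
        | cons y w => exact ⟨y, hp.subset (by simp), ⟨hp, hw⟩, by simp⟩
      · rintro ⟨_, _, h, _⟩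
        exact h
    · intro x _ y _ hxy
      rw [Function.onFun, Finset.disjoint_left]
      intro w hw hw'
      exact hxy (by simpa using (Finset.mem_filter.1 hw).2.symm.trans (Finset.mem_filter.1 hw').2)

/-- The letters of the words in `S_8`. -/
def letters8 : List ℕ :=
  [nat_lit 0, nat_lit 1, nat_lit 2, nat_lit 3, nat_lit 4, nat_lit 5, nat_lit 6, nat_lit 7]

/-! ### Machines for the parts of `W*` -/

/-- Membership in a list. -/
def memN (x : ℕ) (l : List ℕ) : Bool :=
  List.rec false (fun y _ ih => Bool.rec ih true (Nat.beq x y)) l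

/-- Row insertion of a natural number, in continuation passing style. -/
def rowIns {β : Type} (x : ℕ) (r : List ℕ) : (List ℕ → Option ℕ → β) → β :=
  List.rec (fun k => k [x] none)
    (fun y r ih k => Bool.rec (k (x :: r) (some y)) (ih fun r' o => k (y :: r') o) (Nat.ble y x)) r

/-- Insertion of a natural number into a tableau. -/
def tabIns (T : List (List ℕ)) : ℕ → List (List ℕ) :=
  List.rec (fun x => [[x]])
    (fun r T ih x => rowIns x r fun r' o => Option.rec (r' :: T) (fun y => r' :: ih y) o) T

/-- All rows have length at most `2`. -/
def thin (T : List (List ℕ)) : Bool :=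
  List.rec true (fun r _ ih => Bool.rec false ih (Nat.ble r.length (nat_lit 2))) T

/-- The number of entries `y` of a list with `x < y < x + k`. -/
def countAbove (k x : ℕ) (p : List ℕ) : ℕ :=
  List.rec Nat.zero
    (fun y _ ih => Bool.rec ih (Bool.rec ih (Nat.succ ih) (Nat.ble (Nat.succ y) (Nat.add x k)))
      (Nat.ble (Nat.succ x) y)) p

/-- The `k`-inversion number of the reverse of a word. -/
def invRev (k : ℕ) (p : List ℕ) : ℕ :=
  List.rec Nat.zero (fun x p ih => Nat.add (countAbove k x p) ih) p

/-- Insert a letter into a tableau, as long as its shape is contained in `(2, 2, 2, 2)`. -/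
def stepKnuth : Machine := fun T x =>
  Bool.rec none (some (tabIns T x))
    (Bool.rec false (thin (tabIns T x)) (Nat.ble (tabIns T x).length (nat_lit 4)))

/-- Record the word read, as long as every letter `x ≤ 4` comes after `x + 3`. -/
def step3 : Machine := fun s x =>
  Bool.rec (Bool.rec none (some [x :: s.headD []]) (memN (Nat.add x (nat_lit 3)) (s.headD [])))
    (some [x :: s.headD []]) (Nat.ble (nat_lit 5) x)

/-- The new state of `step7`, where `c` is the new number of noninversions. -/
def next7 (p : List ℕ) (x c : ℕ) : Option (List (List ℕ)) :=
  Bool.rec none (some [[c], x :: p])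
    (Bool.rec
      (Nat.ble (Nat.add c (Bool.rec (Nat.succ p.length) Nat.zero (memN (nat_lit 7) p)))
        (nat_lit 10))
      (Bool.rec false (Nat.ble c (nat_lit 10)) (memN (nat_lit 0) p))
      (Nat.beq x (nat_lit 7)))

/-- Record the word read and its number of pairs that are not 7-inversions, as long as this number
can still be at most `10` in the end and `7` comes after `0`. -/
def step7 : Machine := fun s x =>
  forceNat (Nat.add ((s.headD []).headD 0)
    (Nat.sub (s.tail.headD []).length (countAbove (nat_lit 7) x (s.tail.headD []))))
    (next7 (s.tail.headD []) x)

/-- Record the word read, as long as it decreases, except perhaps after the first `d` letters. -/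
def stepDecr (d : ℕ) : Machine := fun s x =>
  Bool.rec none (some [x :: s.headD []])
    (Bool.rec (Nat.ble (Nat.succ x) ((s.headD []).headD (Nat.succ x))) true
      (Nat.beq (s.headD []).length d))

def inKnuth (w : List ℕ) : Bool :=
  Option.rec false (fun T => decide (T.map List.length = [2, 2, 2, 2] ∧
    T ≠ [[0, 1], [2, 3], [4, 5], [6, 7]])) (run stepKnuth w [])

def in3 (w : List ℕ) : Bool :=
  Option.rec false (fun s => Nat.beq (invRev (nat_lit 3) (s.headD [])) (nat_lit 9))
    (run step3 w [[]])

/-- A permutation of 8 letters has 28 pairs of positions, so 18 pairs that are 7-inversions leave 10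
that are not. -/
def in7 (w : List ℕ) : Bool :=
  Option.rec false (fun s => Nat.beq ((s.headD []).headD 0) (nat_lit 10))
    (run step7 w [[nat_lit 0], []])

/-! ### Tests -/

/-- The sum of the values of an indicator function at `v bac w` and `v cab w` is that at `v bca w`
and `v acb w`, where `u` is the reverse of `v`. -/
def balSquare (f : List ℕ → Bool) (u t : List ℕ) (a b c : ℕ) : Bool :=
  Nat.beq
    (Nat.add (f (u.reverseAux (b :: a :: c :: t))).toNat
      (f (u.reverseAux (c :: a :: b :: t))).toNat)
    (Nat.add (f (u.reverseAux (b :: c :: a :: t))).toNat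
      (f (u.reverseAux (a :: c :: b :: t))).toNat)

/-- The balance condition for all squares that contain a word. -/
def balWord (f : List ℕ → Bool) : List ℕ → List ℕ → Bool
  | u, x :: y :: z :: t =>
    (match Nat.blt x y, Nat.blt y z, Nat.blt x z with
      | false, true, true => balSquare f u t y x z
      | true, false, false => balSquare f u t z x y
      | true, false, true => balSquare f u t x z y
      | false, true, false => balSquare f u t y z x
      | _, _, _ => true) && balWord f (x :: u) (y :: z :: t)
  | _, _ => true

/-- The reverse of a word passes the test `f` but not the test `g`. -/
def testRev (f g : List ℕ → Bool) (r : List ℕ) : Bool :=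
  forceList (r.reverseAux []) fun w => Bool.rec false (!(g w)) (f w)

/-- What is counted are counterexamples: members of the Knuth part that lie in an unbalanced square
or in one of the other two parts. The next two counts treat the remaining parts and their
disjointness in the same way. -/
theorem countAcc_knuth : countAcc stepKnuth
    (testRev inKnuth fun w => balWord inKnuth [] w && !(in3 w) && !(in7 w))
    8 letters8 [] [] = 0 := by
  decide +kernel

theorem countAcc_3 : countAcc step3
    (testRev in3 fun w => balWord in3 [] w && !(in7 w)) 8 letters8 [[]] [] = 0 := by
  decide +kernel

theorem countAcc_7 : countAcc step7
    (testRev in7 fun w => balWord in7 [] w) 8 letters8 [[nat_lit 0], []] [] = 0 := by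
  decide +kernel

/-- All of `S_8` would give 70 words here and 56 in the next count, the binomial coefficients of 8
over 4 and 5. So `W*` removes 19 and 4 words, and 14 - 15 = -1 is left for the difference. -/
theorem countAcc_decr4 : countAcc (stepDecr 4)
    (testRev (fun _ => true) fun w => inKnuth w || in3 w || in7 w) 8 letters8 [[]] [] = 51 := by
  decide +kernel

theorem countAcc_decr5 : countAcc (stepDecr 5)
    (testRev (fun _ => true) fun w => inKnuth w || in3 w || in7 w) 8 letters8 [[]] [] = 52 := by
  decide +kernel

/-! ### The Knuth part -/

theorem mem_permWords {N : ℕ} {w : List (Fin N)} : w ∈ permWords N ↔ w.length = N ∧ w.Nodup := by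
  simp only [permWords, Finset.mem_image, Finset.mem_univ, true_and]
  constructor
  · rintro ⟨σ, rfl⟩
    exact ⟨by simp, List.nodup_ofFn.2 σ.injective⟩
  · rintro ⟨h, hw⟩
    refine ⟨Equiv.ofBijective (fun i => w[i.val]'(h.symm ▸ i.isLt)) ?_, ?_⟩
    · refine Finite.injective_iff_bijective.1 fun i j hij => Fin.ext ?_
      exact (List.Nodup.getElem_inj_iff hw).1 hij
    · exact List.ext_getElem (by simp [h]) fun i _ _ => by simp

theorem rowIns_map {N : ℕ} {β : Type} (x : Fin N) (r : List (Fin N))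
    (k : List ℕ → Option ℕ → β) :
    rowIns (x : ℕ) (r.map Fin.val) k =
      k ((rowInsert x r).1.map Fin.val) ((rowInsert x r).2.map Fin.val) := by
  induction r generalizing k with
  | nil => rfl
  | cons y r ih =>
    show (Bool.rec (k (x.val :: r.map Fin.val) (some y.val))
      (rowIns x.val (r.map Fin.val) fun r' o => k (y.val :: r') o) (Nat.ble y x) : β) = _
    rw [ih]
    by_cases h : x < y
    · have h' : Nat.ble y x = false := by
        rw [Bool.eq_false_iff, Ne, Nat.ble_eq]
        exact not_le.2 h
      simp [rowInsert, h, h']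
    · have h' : Nat.ble y x = true := by
        rw [Nat.ble_eq]
        exact not_lt.1 h
      simp [rowInsert, h, h']

theorem tabIns_map {N : ℕ} (x : Fin N) (T : List (List (Fin N))) :
    tabIns (T.map (List.map Fin.val)) (x : ℕ) = (tabInsert x T).map (List.map Fin.val) := by
  induction T generalizing x with
  | nil => rfl
  | cons r T ih =>
    show rowIns (β := List (List ℕ)) x.val (r.map Fin.val) (fun r' o => Option.rec
      (r' :: T.map (List.map Fin.val)) (fun y => r' :: tabIns (T.map (List.map Fin.val)) y) o) = _
    rw [rowIns_map, tabInsert]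
    rcases h : rowInsert x r with ⟨r', _ | y⟩
    · rfl
    · simpa using ih y

theorem foldl_tabIns_map {N : ℕ} (w : List (Fin N)) :
    (w.map Fin.val).foldl tabIns [] = (insTab w).map (List.map Fin.val) := by
  suffices h : ∀ T : List (List (Fin N)), (w.map Fin.val).foldl tabIns (T.map (List.map Fin.val)) =
      (w.foldl (fun T x => tabInsert x T) T).map (List.map Fin.val) from h []
  induction w with
  | nil => exact fun T => rfl
  | cons x w ih =>
    intro T
    rw [List.map_cons, List.foldl_cons, tabIns_map, ih, List.foldl_cons]

/-- The shape is contained in `(2, 2, 2, 2)`. -/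
def Small (T : List (List ℕ)) : Prop := T.length ≤ 4 ∧ ∀ r ∈ T, r.length ≤ 2

/-- The new row and the bumped entry are independent of the continuation, so they can be named once
for all `k`. -/
theorem rowIns_spec (x : ℕ) (r : List ℕ) : ∃ (r' : List ℕ) (o : Option ℕ), r.length ≤ r'.length ∧
    ∀ k : List ℕ → Option ℕ → List (List ℕ), rowIns x r k = k r' o := by
  induction r with
  | nil => exact ⟨[x], none, by simp, fun k => rfl⟩
  | cons y r ih =>
    obtain ⟨r', o, hr, hk⟩ := ih
    cases h : Nat.ble y x with
    | false =>
      refine ⟨x :: r, some y, by simp, fun k => ?_⟩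
      show (Bool.rec _ _ (Nat.ble y x) : List (List ℕ)) = _
      rw [h]
    | true =>
      refine ⟨y :: r', o, by simpa using hr, fun k => ?_⟩
      show (Bool.rec _ (rowIns x r fun r' o => k (y :: r') o) (Nat.ble y x) : List (List ℕ)) = _
      rw [h, hk]

/-- Insertion never shortens a row or removes one. A tableau that has outgrown (2,2,2,2) stays too
large, which justifies stopping the machine there. -/
theorem tabIns_grows (T : List (List ℕ)) (x : ℕ) : T.length ≤ (tabIns T x).length ∧
    ((∀ r ∈ tabIns T x, r.length ≤ 2) → ∀ r ∈ T, r.length ≤ 2) := by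
  induction T generalizing x with
  | nil => simp
  | cons r T ih =>
    obtain ⟨r', o, hr, hk⟩ := rowIns_spec x r
    have h : tabIns (r :: T) x = Option.rec (r' :: T) (fun y => r' :: tabIns T y) o := hk _
    cases o with
    | none =>
      rw [h]
      simp only [List.length_cons, le_refl, List.mem_cons, forall_eq_or_imp, true_and]
      exact fun h' => ⟨hr.trans h'.1, h'.2⟩
    | some y =>
      rw [h]
      simp only [List.length_cons, List.mem_cons, forall_eq_or_imp]
      exact ⟨Nat.succ_le_succ (ih y).1, fun h' => ⟨hr.trans h'.1, (ih y).2 h'.2⟩⟩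

theorem Small.of_tabIns {T : List (List ℕ)} {x : ℕ} (h : Small (tabIns T x)) : Small T :=
  ⟨(tabIns_grows T x).1.trans h.1, (tabIns_grows T x).2 h.2⟩

theorem Small.of_foldl {w : List ℕ} {T : List (List ℕ)} (h : Small (w.foldl tabIns T)) :
    Small T := by
  induction w generalizing T with
  | nil => exact h
  | cons x w ih => exact (ih h).of_tabIns

theorem thin_iff (T : List (List ℕ)) : thin T = true ↔ ∀ r ∈ T, r.length ≤ 2 := by
  induction T with
  | nil => simp [thin]
  | cons r T ih =>
    show (Bool.rec false (thin T) (Nat.ble r.length 2) : Bool) = true ↔ _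
    cases h : Nat.ble r.length 2 with
    | false =>
      have : ¬ r.length ≤ 2 := by rw [← Nat.ble_eq, h]; simp
      simp [this]
    | true =>
      have : r.length ≤ 2 := by rw [← Nat.ble_eq, h]
      simp [this, ih]

open Classical in
theorem stepKnuth_eq (T : List (List ℕ)) (x : ℕ) :
    stepKnuth T x = if Small (tabIns T x) then some (tabIns T x) else none := by
  show (Bool.rec none (some (tabIns T x)) (Bool.rec false (thin (tabIns T x))
    (Nat.ble (tabIns T x).length 4)) : Option (List (List ℕ))) = _
  cases h : Nat.ble (tabIns T x).length 4 with
  | false =>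
    have : ¬ (tabIns T x).length ≤ 4 := by rw [← Nat.ble_eq, h]; simp
    simp [Small, this]
  | true =>
    have : (tabIns T x).length ≤ 4 := by rw [← Nat.ble_eq, h]
    cases h' : thin (tabIns T x) with
    | false =>
      have h2 : ¬ ∀ r ∈ tabIns T x, r.length ≤ 2 := by rw [← thin_iff, h']; simp
      rw [if_neg fun h3 => h2 h3.2]
    | true => rw [if_pos ⟨this, (thin_iff _).1 h'⟩]

open Classical in
theorem run_stepKnuth (w : List ℕ) (T : List (List ℕ)) (hT : Small T) :
    run stepKnuth w T = if Small (w.foldl tabIns T) then some (w.foldl tabIns T) else none := by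
  induction w generalizing T with
  | nil => simp [hT]
  | cons x w ih =>
    rw [run_cons, stepKnuth_eq, List.foldl_cons]
    by_cases h : Small (tabIns T x)
    · rw [if_pos h, Option.bind_some, ih _ h]
    · rw [if_neg h, Option.bind_none, if_neg fun h' => h h'.of_foldl]

theorem inKnuth_iff (w : List ℕ) : inKnuth w = true ↔
    (w.foldl tabIns []).map List.length = [2, 2, 2, 2] ∧
      w.foldl tabIns [] ≠ [[0, 1], [2, 3], [4, 5], [6, 7]] := by
  rw [inKnuth, run_stepKnuth w [] ⟨by simp, by simp⟩]
  split_ifs with h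
  · simp
  · refine iff_of_false (by simp) fun h' => h ⟨?_, fun r hr => ?_⟩
    · rw [← List.length_map, h'.1]
      simp
    · have := List.mem_map_of_mem (f := List.length) hr
      rw [h'.1] at this
      simp at this
      omega

theorem mem_knuthPart {w : List (Fin 8)} :
    w ∈ knuthPart ↔ w ∈ permWords 8 ∧ inKnuth (w.map Fin.val) = true := by
  rw [knuthPart, Finset.mem_filter, inKnuth_iff, foldl_tabIns_map, List.map_map]
  refine and_congr_right fun _ => and_congr (Eq.congr_left ?_) (not_congr ?_)
  · exact List.map_congr_left fun r _ => by simp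
  · rw [show ([[0, 1], [2, 3], [4, 5], [6, 7]] : List (List ℕ)) =
      List.map (List.map Fin.val) ([[0, 1], [2, 3], [4, 5], [6, 7]] : List (List (Fin 8))) from rfl]
    exact ((List.map_injective_iff.2 (List.map_injective_iff.2 Fin.val_injective)).eq_iff).symm

/-- Every member is accepted by the machine, so a search restricted to accepted words misses none of
them. -/
theorem isSome_run_of_inKnuth {w : List ℕ} (h : inKnuth w = true) :
    (run stepKnuth w []).isSome := by
  rw [inKnuth] at h
  cases h' : run stepKnuth w [] with
  | none => rw [h'] at h; simp at h
  | some _ => rfl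

/-! ### The LLT parts -/

theorem memN_iff (x : ℕ) (l : List ℕ) : memN x l = true ↔ x ∈ l := by
  induction l with
  | nil => simp [memN]
  | cons y l ih =>
    show (Bool.rec (memN x l) true (Nat.beq x y) : Bool) = true ↔ _
    cases h : Nat.beq x y with
    | false =>
      have : x ≠ y := Nat.ne_of_beq_eq_false h
      simpa [this] using ih
    | true => simp [Nat.eq_of_beq_eq_true h]

/-! ### Inversion numbers computed from reversed words. -/

theorem countAbove_cons (k x y : ℕ) (p : List ℕ) :
    countAbove k x (y :: p) = (if x < y ∧ y < x + k then 1 else 0) + countAbove k x p := by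
  show (Bool.rec (countAbove k x p) (Bool.rec (countAbove k x p) (Nat.succ (countAbove k x p))
    (Nat.ble (Nat.succ y) (Nat.add x k))) (Nat.ble (Nat.succ x) y) : ℕ) = _
  have h1 : Nat.ble (Nat.succ x) y = decide (x < y) := by
    rw [Bool.eq_iff_iff, Nat.ble_eq, decide_eq_true_iff, Nat.succ_le_iff]
  have h2 : Nat.ble (Nat.succ y) (Nat.add x k) = decide (y < x + k) := by
    rw [Bool.eq_iff_iff, Nat.ble_eq, decide_eq_true_iff, Nat.succ_le_iff]
    rfl
  rw [h1, h2]
  by_cases hx : x < y <;> by_cases hy : y < x + k <;> simp [hx, hy, Nat.add_comm 1]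

theorem countAbove_append (k x : ℕ) (p q : List ℕ) :
    countAbove k x (p ++ q) = countAbove k x p + countAbove k x q := by
  induction p with
  | nil => simp [countAbove]
  | cons y p ih => rw [List.cons_append, countAbove_cons, countAbove_cons, ih, add_assoc]

theorem invRev_cons (k x : ℕ) (p : List ℕ) : invRev k (x :: p) = countAbove k x p + invRev k p :=
  rfl

/-- The recursion for `kInv` removes the first letter of a word, which is the last entry of its
reverse, whereas `invRev` is defined by removing the head. -/
theorem invRev_append_singleton (k x : ℕ) (p : List ℕ) :
    invRev k (p ++ [x]) = invRev k p + (p.map fun y => if y < x ∧ x < y + k then 1 else 0).sum := by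
  induction p with
  | nil => simp [invRev, countAbove]
  | cons y p ih =>
    rw [List.cons_append, invRev_cons, invRev_cons, ih, countAbove_append, countAbove_cons,
      List.map_cons, List.sum_cons]
    rw [show countAbove k y [] = 0 from rfl]
    omega

theorem kInv_eq_sum {N : ℕ} (k : ℕ) (w : List (Fin N)) : kInv k w =
    ∑ i : Fin w.length, ∑ j : Fin w.length, if i < j ∧ 0 < letterVal w[i] - letterVal w[j] ∧
      letterVal w[i] - letterVal w[j] < k then 1 else 0 := by
  rw [kInv, Finset.card_filter, ← Finset.univ_product_univ, Finset.sum_product]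

theorem kInv_cons {N : ℕ} (k : ℕ) (x : Fin N) (w : List (Fin N)) : kInv k (x :: w) =
    (w.map fun y => if y.val < x.val ∧ x.val < y.val + k then 1 else 0).sum + kInv k w := by
  rw [kInv_eq_sum, kInv_eq_sum]
  refine (Fin.sum_univ_succ _).trans ?_
  congr 1
  · refine (Fin.sum_univ_succ _).trans ?_
    simp only [lt_irrefl, false_and, if_false, zero_add, Fin.succ_pos, true_and]
    rw [← List.sum_ofFn]
    congr 1
    apply List.ext_getElem (by simp)
    intro i h1 h2
    simp only [letterVal, Fin.getElem_fin, List.getElem_ofFn, List.getElem_map, Fin.val_zero,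
      List.getElem_cons_zero, Fin.val_succ, List.getElem_cons_succ]
    congr 1
    rw [eq_iff_iff]
    constructor <;> intro h <;> omega
  · refine Finset.sum_congr rfl fun i _ => ?_
    refine (Fin.sum_univ_succ _).trans ?_
    simp [Fin.succ_lt_succ_iff]

theorem kInv_eq_invRev {N : ℕ} (k : ℕ) (w : List (Fin N)) :
    kInv k w = invRev k (w.map Fin.val).reverse := by
  induction w with
  | nil => simp [kInv_eq_sum, invRev]
  | cons x w ih =>
    rw [kInv_cons, List.map_cons, List.reverse_cons, invRev_append_singleton, ih, add_comm,
      List.map_reverse, List.sum_reverse, List.map_map]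
    rfl

/-! ### Precedence of letters, and the class for k = 3. -/

/-- The letter `a` occurs before the letter `b`. -/
def Before (a b : ℕ) : List ℕ → Prop
  | [] => False
  | x :: w => x = a ∧ b ∈ w ∨ Before a b w

theorem Before.mem_right {a b : ℕ} {w : List ℕ} (h : Before a b w) : b ∈ w := by
  induction w with
  | nil => exact h.elim
  | cons x w ih => exact List.mem_cons_of_mem _ (h.elim And.right ih)

theorem occursBefore_iff {N : ℕ} (w : List (Fin N)) (a b : ℕ) :
    OccursBefore w (a + 1) (b + 1) ↔ Before a b (w.map Fin.val) := by
  induction w with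
  | nil => simp [OccursBefore, Before]
  | cons x w ih =>
    rw [List.map_cons, Before, ← ih]
    constructor
    · rintro ⟨i, j, hij, hi, hj⟩
      obtain ⟨j, rfl⟩ := Fin.exists_succ_eq.2 (Fin.ne_zero_of_lt hij)
      have hj' : w[j].val = b := by simpa [letterVal] using hj
      refine Fin.cases (fun hij hi => ?_) (fun i hij hi => ?_) i hij hi
      · exact Or.inl ⟨by simpa [letterVal] using hi,
          List.mem_map.2 ⟨w[j], List.getElem_mem _, hj'⟩⟩
      · exact Or.inr ⟨i, j, by simpa using hij, by simpa using hi, by simpa using hj⟩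
    · rintro (⟨hx, hb⟩ | ⟨i, j, hij, hi, hj⟩)
      · obtain ⟨y, hy, hyb⟩ := List.mem_map.1 hb
        obtain ⟨j, hj, rfl⟩ := List.getElem_of_mem hy
        exact ⟨(0 : Fin (w.length + 1)), (⟨j, hj⟩ : Fin w.length).succ, Fin.succ_pos _,
          by simp [letterVal, hx], by simp [letterVal, hyb]⟩
      · exact ⟨i.succ, j.succ, by simpa using hij, by simpa using hi, by simpa using hj⟩

theorem step3_eq (p : List ℕ) (x : ℕ) :
    step3 [p] x = if 5 ≤ x ∨ x + 3 ∈ p then some [x :: p] else none := by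
  show (Bool.rec (Bool.rec none (some [x :: p]) (memN (x + 3) p)) (some [x :: p]) (Nat.ble 5 x) :
    Option (List (List ℕ))) = _
  have h1 : Nat.ble 5 x = decide (5 ≤ x) := by
    rw [Bool.eq_iff_iff, Nat.ble_eq, decide_eq_true_iff]
  have h2 : memN (x + 3) p = decide (x + 3 ∈ p) := by
    rw [Bool.eq_iff_iff, memN_iff, decide_eq_true_iff]
  rw [h1, h2]
  by_cases h : 5 ≤ x <;> by_cases h' : x + 3 ∈ p <;> simp [h, h']

-- For letters below 5, the letter `x + 3` must either have been read already, being in `p`, or come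
-- before `x` in the rest of the word. Reading `y` turns the second alternative into the first for
-- `x + 3 = y`.
open Classical in
theorem run_step3 (w p : List ℕ) (hw : w.Nodup) : run step3 w [p] =
    if ∀ x ∈ w, 5 ≤ x ∨ x + 3 ∈ p ∨ Before (x + 3) x w then some [w.reverse ++ p] else none := by
  induction w generalizing p with
  | nil => simp
  | cons y w ih =>
    have hy := List.nodup_cons.1 hw
    have key : (∀ x ∈ y :: w, 5 ≤ x ∨ x + 3 ∈ p ∨ Before (x + 3) x (y :: w)) ↔
        (5 ≤ y ∨ y + 3 ∈ p) ∧ ∀ x ∈ w, 5 ≤ x ∨ x + 3 ∈ y :: p ∨ Before (x + 3) x w := by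
      rw [List.forall_mem_cons]
      refine and_congr ?_ (forall₂_congr fun x hx => ?_)
      · have : ¬ Before (y + 3) y (y :: w) := by
          rintro (h | h)
          · exact hy.1 h.2
          · exact hy.1 h.mem_right
        simp [this]
      · simp only [Before, List.mem_cons, hx, and_true]
        rw [eq_comm (a := y)]
        tauto
    rw [run_cons, step3_eq]
    by_cases h : 5 ≤ y ∨ y + 3 ∈ p
    · rw [if_pos h, Option.bind_some, ih _ hy.2]
      simp only [key, h, true_and, List.reverse_cons, List.append_assoc, List.singleton_append]
    · rw [if_neg h, Option.bind_none, if_neg fun h' => h (key.1 h').1]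

theorem perm_letters8 {w : List (Fin 8)} (hw : w ∈ permWords 8) :
    (w.map Fin.val).Perm letters8 := by
  obtain ⟨hl, hn⟩ := mem_permWords.1 hw
  have h : w.Perm (List.finRange 8) := by
    rw [List.perm_ext_iff_of_nodup hn (List.nodup_finRange 8)]
    intro a
    refine iff_of_true ?_ (List.mem_finRange a)
    have : w.toFinset = Finset.univ := by
      rw [← Finset.card_eq_iff_eq_univ, List.toFinset_card_of_nodup hn, hl]
      rfl
    exact List.mem_toFinset.1 (this ▸ Finset.mem_univ a)
  exact h.map Fin.val

theorem mem_map_val {w : List (Fin 8)} (hw : w ∈ permWords 8) {x : ℕ} :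
    x ∈ w.map Fin.val ↔ x < 8 := by
  rw [(perm_letters8 hw).mem_iff, show letters8 = [0, 1, 2, 3, 4, 5, 6, 7] from rfl]
  constructor
  · intro h
    simp only [List.mem_cons, List.not_mem_nil, or_false] at h
    omega
  · intro h
    interval_cases x <;> simp

theorem coe_eq_univ_val {w : List (Fin 8)} (hw : w ∈ permWords 8) :
    (w : Multiset (Fin 8)).map letterVal =
      (Finset.univ : Finset (Fin 8)).val.map letterVal := by
  obtain ⟨hl, hn⟩ := mem_permWords.1 hw
  have : w.toFinset = Finset.univ := by
    rw [← Finset.card_eq_iff_eq_univ, List.toFinset_card_of_nodup hn, hl]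
    rfl
  rw [← this, List.toFinset_val, hn.dedup]

/-- Once the shifted contents are exactly 1, …, 8, every permutation is a rearrangement of them, and
only the precedence conditions remain. -/
theorem mem_lltWords_iff {k : ℕ} {β : Fin k → SkewShape}
    (h : (Finset.univ : Finset (Fin 8)).val.map letterVal =
      ∑ i : Fin k, (β i).cells.val.map (shiftedContent k i))
    {w : List (Fin 8)} (hw : w ∈ permWords 8) :
    w ∈ lltWords 8 β ↔ ∀ (i : Fin k), ∀ z ∈ (β i).cells, ∀ z' ∈ (β i).cells,
      (z' = (z.1, z.2 + 1) ∨ z' = (z.1 + 1, z.2)) →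
        OccursBefore w (shiftedContent k i z) (shiftedContent k i z') := by
  have : (w : Multiset (Fin 8)).map letterVal =
      ∑ i : Fin k, (β i).cells.val.map (shiftedContent k i) := (coe_eq_univ_val hw).trans h
  exact ⟨fun h => h.2.2, fun h => ⟨(mem_permWords.1 hw).2, this, h⟩⟩

theorem cells_beta3 : (beta3 0).cells = {(0, 2), (1, 2)} ∧
    (beta3 1).cells = {(0, 2), (1, 2), (2, 2)} ∧ (beta3 2).cells = {(0, 2), (1, 2), (2, 2)} := by
  decide

/-- The three shapes are columns with shifted contents 6, 3 and 7, 4, 1 and 8, 5, 2 from top to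
bottom. With letters counted from 0, each `x ≤ 4` must come after `x + 3`. The membership in `[]`
gives the condition the form that `run_step3` has at the start. -/
theorem mem_lltWords_beta3 {w : List (Fin 8)} (hw : w ∈ permWords 8) :
    w ∈ lltWords 8 beta3 ↔
      ∀ x ∈ w.map Fin.val, 5 ≤ x ∨ x + 3 ∈ ([] : List ℕ) ∨ Before (x + 3) x (w.map Fin.val) := by
  have h0 := occursBefore_iff w 3 0
  have h1 := occursBefore_iff w 4 1
  have h2 := occursBefore_iff w 5 2
  have h3 := occursBefore_iff w 6 3
  have h4 := occursBefore_iff w 7 4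
  norm_num at h0 h1 h2 h3 h4
  rw [mem_lltWords_iff (by decide) hw, Fin.forall_fin_succ, Fin.forall_fin_succ,
    Fin.forall_fin_one]
  simp only [mem_map_val hw, Fin.succ_zero_eq_one, Fin.succ_one_eq_two, cells_beta3,
    Finset.forall_mem_insert, Finset.mem_singleton, forall_eq, shiftedContent]
  norm_num [h0, h1, h2, h3, h4]
  constructor
  · rintro ⟨_, ⟨_, _⟩, _, _⟩ x hx
    interval_cases x <;> simp_all
  · intro h
    have g0 := h 0 (by norm_num)
    have g1 := h 1 (by norm_num)
    have g2 := h 2 (by norm_num)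
    have g3 := h 3 (by norm_num)
    have g4 := h 4 (by norm_num)
    simp_all

open Classical in
theorem mem_lltPart3 {w : List (Fin 8)} :
    w ∈ lltPart3 ↔ w ∈ permWords 8 ∧ in3 (w.map Fin.val) = true := by
  rw [lltPart3, Finset.mem_filter]
  refine and_congr_right fun hw => ?_
  rw [mem_lltWords_beta3 hw, kInv_eq_invRev, in3,
    run_step3 _ [] ((perm_letters8 hw).nodup_iff.2 (by decide))]
  split_ifs with h
  · rw [and_iff_right h]
    show _ ↔ Nat.beq (invRev 3 ((w.map Fin.val).reverse ++ [])) 9 = true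
    rw [List.append_nil, Nat.beq_eq]
  · exact iff_of_false (fun h' => h h'.1) (by simp)

theorem isSome_run_of_in3 {w : List ℕ} (h : in3 w = true) : (run step3 w [[]]).isSome := by
  rw [in3] at h
  cases h' : run step3 w [[]] with
  | none => rw [h'] at h; simp at h
  | some _ => rfl

theorem isSome_run_of_in7 {w : List ℕ} (h : in7 w = true) :
    (run step7 w [[0], []]).isSome := by
  rw [in7] at h
  change (run step7 w [[nat_lit 0], []]).isSome
  cases h' : run step7 w [[nat_lit 0], []] with
  | none => rw [h'] at h; simp at h
  | some _ => rfl

/-! ### The class for k = 7. -/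

theorem cells_beta7 : (beta7 0).cells = {(0, 1)} ∧ (beta7 1).cells = {(0, 0), (0, 1)} ∧
    (beta7 2).cells = {(0, 0)} ∧ (beta7 3).cells = {(0, 0)} ∧ (beta7 4).cells = {(0, 0)} ∧
    (beta7 5).cells = {(0, 0)} ∧ (beta7 6).cells = {(0, 0)} := by
  decide

/-- Only the second shape has two cells; their shifted contents are 1 and 8. -/
theorem mem_lltWords_beta7 {w : List (Fin 8)} (hw : w ∈ permWords 8) :
    w ∈ lltWords 8 beta7 ↔ Before 0 7 (w.map Fin.val) := by
  have h0 := occursBefore_iff w 0 7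
  norm_num at h0
  obtain ⟨c0, c1, c2, c3, c4, c5, c6⟩ := cells_beta7
  rw [mem_lltWords_iff (by decide) hw, ← h0]
  constructor
  · intro h
    simpa [shiftedContent] using h 1 (0, 0) (by simp [c1]) (0, 1) (by simp [c1]) (by simp)
  · intro h i
    fin_cases i <;> simp [c0, c1, c2, c3, c4, c5, c6, shiftedContent, h]

/-- The number of pairs in the reverse of a word that are not 7-inversions. -/
def nonInv7 : List ℕ → ℕ
  | [] => 0
  | x :: p => nonInv7 p + (p.length - countAbove 7 x p)

theorem countAbove_le (k x : ℕ) (p : List ℕ) : countAbove k x p ≤ p.length := by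
  induction p with
  | nil => exact le_rfl
  | cons y p ih =>
    rw [countAbove_cons, List.length_cons]
    split_ifs <;> omega

theorem nonInv7_add_invRev (p : List ℕ) : nonInv7 p + invRev 7 p = p.length.choose 2 := by
  induction p with
  | nil => rfl
  | cons x p ih =>
    have := countAbove_le 7 x p
    rw [nonInv7, invRev_cons, List.length_cons, Nat.choose_succ_succ, Nat.choose_one_right, ← ih]
    omega

theorem next7_eq (p : List ℕ) (x c : ℕ) : next7 p x c =
    if (x = 7 → 0 ∈ p ∧ c ≤ 10) ∧ (x ≠ 7 → c + (if 7 ∈ p then 0 else p.length + 1) ≤ 10) then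
      some [[c], x :: p] else none := by
  show (Bool.rec none (some [[c], x :: p])
    (Bool.rec
      (Nat.ble (Nat.add c (Bool.rec (Nat.succ p.length) Nat.zero (memN 7 p))) 10)
      (Bool.rec false (Nat.ble c 10) (memN 0 p)) (Nat.beq x 7)) : Option (List (List ℕ))) = _
  have h1 : Nat.beq x 7 = decide (x = 7) := by
    rw [Bool.eq_iff_iff, Nat.beq_eq, decide_eq_true_iff]
  have h2 : memN 7 p = decide (7 ∈ p) := by
    rw [Bool.eq_iff_iff, memN_iff, decide_eq_true_iff]
  have h3 : memN 0 p = decide (0 ∈ p) := by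
    rw [Bool.eq_iff_iff, memN_iff, decide_eq_true_iff]
  have h4 : ∀ n, Nat.ble n 10 = decide (n ≤ 10) := fun n => by
    rw [Bool.eq_iff_iff, Nat.ble_eq, decide_eq_true_iff]
  rw [h1, h2, h3, h4, h4]
  by_cases hx : x = 7
  · by_cases h0 : 0 ∈ p <;> by_cases hc : c ≤ 10 <;> simp [hx, h0, hc]
  · by_cases h7 : 7 ∈ p
    · by_cases hc : c ≤ 10 <;> simp [hx, h7, hc]
    · by_cases hc : c + (p.length + 1) ≤ 10 <;> simp [hx, h7, hc]

theorem step7_eq (p : List ℕ) (x : ℕ) : step7 [[nonInv7 p], p] x =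
    if (x = 7 → 0 ∈ p ∧ nonInv7 (x :: p) ≤ 10) ∧
      (x ≠ 7 → nonInv7 (x :: p) + (if 7 ∈ p then 0 else p.length + 1) ≤ 10) then
      some [[nonInv7 (x :: p)], x :: p] else none :=
  (forceNat_eq _ _).trans (next7_eq p x _)

/-- A lower bound for the number of noninversions of a word with a given beginning. -/
def bound7 (p : List ℕ) : ℕ := nonInv7 p + if 7 ∈ p then 0 else p.length

theorem countAbove_eq_zero {k x : ℕ} {p : List ℕ} (hp : ∀ y ∈ p, y < x + 1) :
    countAbove k x p = 0 := by
  induction p with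
  | nil => rfl
  | cons y p ih =>
    have := hp y (by simp)
    rw [countAbove_cons, ih fun z hz => hp z (by simp [hz]), if_neg (by omega)]

/-- While 7 is unread, each letter in `p` will precede it and form a noninversion with it, which
accounts for the term `p.length`. When 7 is read, exactly these pairs enter `nonInv7`. -/
theorem bound7_le_cons (p : List ℕ) (x : ℕ) (hp : ∀ y ∈ p, y < 8) :
    bound7 p ≤ bound7 (x :: p) := by
  rw [bound7, bound7, nonInv7]
  by_cases hx : x = 7
  · subst hx
    rw [countAbove_eq_zero hp, if_pos List.mem_cons_self]
    split_ifs <;> omega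
  · simp only [List.mem_cons, Ne.symm hx, false_or, List.length_cons]
    split_ifs <;> omega

theorem bound7_le_append (p q : List ℕ) (hp : ∀ y ∈ p, y < 8) (hq : ∀ y ∈ q, y < 8) :
    bound7 p ≤ bound7 (q ++ p) := by
  induction q with
  | nil => exact le_rfl
  | cons x q ih =>
    refine (ih fun y hy => hq y (by simp [hy])).trans (bound7_le_cons _ _ fun y hy => ?_)
    rcases List.mem_append.1 hy with h | h
    · exact hq y (by simp [h])
    · exact hp y h

-- The bound tested at each step is at most the final number of noninversions. If that number is at
-- most 10 the test never fails, and only reading 7 before 0 can stop the machine.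
open Classical in
theorem run_step7 (w p : List ℕ) (hw : ∀ y ∈ w, y < 8) (hp : ∀ y ∈ p, y < 8)
    (hn : (w.reverse ++ p).Nodup) (h7 : 7 ∈ w.reverse ++ p)
    (h10 : nonInv7 (w.reverse ++ p) ≤ 10) :
    run step7 w [[nonInv7 p], p] = if 7 ∈ w → 0 ∈ p ∨ Before 0 7 w then
      some [[nonInv7 (w.reverse ++ p)], w.reverse ++ p] else none := by
  induction w generalizing p with
  | nil => simp
  | cons x w ih =>
    have e : (x :: w).reverse ++ p = w.reverse ++ x :: p := by simp
    rw [e] at hn h7 h10 ⊢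
    have hp' : ∀ y ∈ x :: p, y < 8 := by
      intro y hy
      rcases List.mem_cons.1 hy with rfl | hy
      · exact hw y (by simp)
      · exact hp y hy
    have hw' : ∀ y ∈ w, y < 8 := fun y hy => hw y (by simp [hy])
    have hb := bound7_le_append (x :: p) w.reverse hp' (by simpa using hw')
    rw [bound7, bound7, if_pos h7, add_zero] at hb
    have hx : x ∉ w ∧ x ∉ p := by
      rw [List.nodup_append] at hn
      refine ⟨fun h => hn.2.2 x (by simpa using h) x (by simp) rfl, (List.nodup_cons.1 hn.2.1).1⟩
    rw [run_cons, step7_eq]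
    by_cases h : x = 7
    · subst h
      by_cases h0 : 0 ∈ p
      · rw [if_pos ⟨fun _ => ⟨h0, by simp at hb; omega⟩, fun h => (h rfl).elim⟩, Option.bind_some,
          ih _ hw' hp' hn h7 h10, if_pos (fun h => (hx.1 h).elim), if_pos fun _ => Or.inl h0]
      · rw [if_neg fun h => h0 (h.1 rfl).1, Option.bind_none, if_neg]
        intro h
        rcases h (by simp) with h | h | h
        · exact h0 h
        · exact absurd h.1 (by norm_num)
        · exact hx.1 h.mem_right
    · have hc : nonInv7 (x :: p) + (if 7 ∈ p then 0 else p.length + 1) ≤ 10 := by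
        simp only [List.mem_cons, Ne.symm h, false_or, List.length_cons] at hb
        exact hb.trans h10
      rw [if_pos ⟨fun h' => (h h').elim, fun _ => hc⟩, Option.bind_some,
          ih _ hw' hp' hn h7 h10]
      refine if_congr ?_ rfl rfl
      simp only [List.mem_cons, Before, Ne.symm h, false_or]
      refine forall_congr' fun h' => ?_
      simp only [h', and_true]
      rw [eq_comm (a := x)]
      tauto

theorem eq_of_run_step7 (w p : List ℕ) (s : List (List ℕ))
    (h : run step7 w [[nonInv7 p], p] = some s) : s = [[nonInv7 (w.reverse ++ p)], w.reverse ++ p] := by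
  induction w generalizing p with
  | nil => simpa using h.symm
  | cons x w ih =>
    rw [run_cons] at h
    obtain ⟨s', h1, h2⟩ := Option.bind_eq_some_iff.1 h
    rw [step7_eq, Option.ite_none_right_eq_some] at h1
    obtain rfl := Option.some.inj h1.2
    simpa using ih _ h2

open Classical in
theorem mem_lltPart7 {w : List (Fin 8)} :
    w ∈ lltPart7 ↔ w ∈ permWords 8 ∧ in7 (w.map Fin.val) = true := by
  rw [lltPart7, Finset.mem_filter]
  refine and_congr_right fun hw => ?_
  have hp := perm_letters8 hw
  have h1 : ∀ y ∈ w.map Fin.val, y < 8 := fun y hy => (mem_map_val hw).1 hy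
  have h2 := nonInv7_add_invRev (w.map Fin.val).reverse
  rw [List.length_reverse, hp.length_eq, show letters8.length.choose 2 = 28 from rfl] at h2
  rw [mem_lltWords_beta7 hw, kInv_eq_invRev, in7]
  generalize w.map Fin.val = v at *
  have h7 : 7 ∈ v := hp.mem_iff.2 (by decide)
  have hn : (v.reverse ++ []).Nodup := by
    simpa using hp.nodup_iff.2 (by decide)
  change _ ↔ (Option.rec false (fun s : List (List ℕ) => Nat.beq ((s.headD []).headD 0) 10)
    (run step7 v [[nonInv7 []], []]) : Bool) = true
  by_cases h10 : nonInv7 (v.reverse ++ []) ≤ 10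
  · rw [run_step7 v [] h1 (by simp) hn (by simpa using h7) h10]
    rw [List.append_nil] at *
    split_ifs with h
    · have hB : Before 0 7 v := by simpa using h h7
      simp only [hB, true_and, List.headD_cons]
      rw [Nat.beq_eq]
      omega
    · simp only [h7, List.not_mem_nil, false_or, true_imp_iff] at h
      simp [h]
  -- With more than 10 noninversions the machine may stop early or not; if it finishes, it has
  -- recorded the true number, which is not 10.
  · cases h : run step7 v [[nonInv7 []], []] with
    | none =>
      rw [List.append_nil] at *
      simp only [Bool.false_eq_true, iff_false, not_and]
      omega
    | some s =>
      rw [eq_of_run_step7 _ _ _ h]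
      simp only [List.append_nil, List.headD_cons, Nat.beq_eq] at *
      omega

theorem mem_Wstar {w : List (Fin 8)} : w ∈ Wstar ↔ w ∈ permWords 8 ∧
    (inKnuth (w.map Fin.val) = true ∨ in3 (w.map Fin.val) = true ∨ in7 (w.map Fin.val) = true) := by
  rw [Wstar, Finset.mem_union, Finset.mem_union, mem_knuthPart, mem_lltPart3, mem_lltPart7,
    ← and_or_left, ← and_or_left, or_assoc]

/-! ### Balance and descent counts for `W̄*` -/

/-- The indicator function of a set of words, extended linearly to `U N`, vanishes on the multiples
of the elements `b(ac - ca) - (ac - ca)b` by words. -/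
def Balanced {N : ℕ} (W : Finset (List (Fin N))) : Prop :=
  ∀ (v t : List (Fin N)) (a b c : Fin N), a < b → b < c →
    (if v ++ [b, a, c] ++ t ∈ W then 1 else 0) + (if v ++ [c, a, b] ++ t ∈ W then 1 else 0) =
      (if v ++ [b, c, a] ++ t ∈ W then 1 else 0) +
        (if v ++ [a, c, b] ++ t ∈ W then (1 : ℤ) else 0)

/-- All positions are descents, except perhaps the one after the first `d` letters. -/
def DecrExcept {N : ℕ} (d : ℕ) (w : List (Fin N)) : Prop :=
  ∀ (j : ℕ) (h : j + 1 < w.length), j + 1 ≠ d → w[j + 1] < w[j]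

/-! ### From the exhaustive counts to balance. -/

theorem testRev_reverse (f g : List ℕ → Bool) (w : List ℕ) :
    testRev f g (w.reverse ++ []) = true ↔ f w = true ∧ g w = false := by
  rw [testRev, forceList_eq, List.append_nil, List.reverseAux_eq, List.append_nil,
    List.reverse_reverse]
  cases f w <;> simp

theorem test_of_countAcc_eq_zero {step : Machine} {f g : List ℕ → Bool} {s : List (List ℕ)}
    (h : countAcc step (testRev f g) 8 letters8 s [] = 0) {w : List ℕ} (hw : w.Perm letters8)
    (hs : (run step w s).isSome) (hf : f w = true) : g w = true := by
  rw [← card_filter_run _ _ _ _ _ _ (by decide) (by rfl), Finset.card_eq_zero,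
    Finset.filter_eq_empty_iff] at h
  by_contra hg
  refine h (List.mem_toFinset.2 (List.mem_permutations.2 hw)) ⟨hs, ?_⟩
  exact (testRev_reverse f g w).2 ⟨hf, by simpa using hg⟩

theorem balWord_append {f : List ℕ → Bool} {u v r : List ℕ} (h : balWord f u (v ++ r) = true) :
    balWord f (v.reverse ++ u) r = true := by
  induction v generalizing u with
  | nil => exact h
  | cons x v ih =>
    rw [List.reverse_cons, List.append_assoc]
    refine ih (u := x :: u) ?_
    rw [List.cons_append] at h
    rcases hv : v ++ r with _ | ⟨y, _ | ⟨z, t⟩⟩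
    · simp [balWord]
    · simp [balWord]
    · rw [hv, balWord, Bool.and_eq_true] at h
      exact h.2

theorem blt_eq (x y : ℕ) : Nat.blt x y = decide (x < y) := by
  rw [Bool.eq_iff_iff, Nat.blt_eq, decide_eq_true_iff]

theorem balSquare_of_balWord {f : List ℕ → Bool} {u t x : List ℕ} {a b c : ℕ} (hab : a < b)
    (hbc : b < c) (hx : x = [b, a, c] ∨ x = [c, a, b] ∨ x = [b, c, a] ∨ x = [a, c, b])
    (h : balWord f u (x ++ t) = true) : balSquare f u t a b c = true := by
  have h1 := hab.asymm
  have h2 := hbc.asymm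
  have h3 := hab.trans hbc
  have h4 := h3.asymm
  rcases hx with rfl | rfl | rfl | rfl <;>
    simp only [balWord, List.cons_append, blt_eq, hab, hbc, h1, h2, h3, h4, decide_true,
      decide_false, Bool.and_eq_true] at h <;> exact h.1

/-- A square without a word satisfying `f` is balanced as 0 = 0, so it is enough to test the squares
around the words that satisfy `f`. -/
theorem toNat_balanced {f : List ℕ → Bool}
    (hf : ∀ w : List ℕ, w.Perm letters8 → f w = true → balWord f [] w = true) (v t : List ℕ)
    {a b c : ℕ} (hab : a < b) (hbc : b < c) (hp : (v ++ [b, a, c] ++ t).Perm letters8) :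
    (f (v ++ [b, a, c] ++ t)).toNat + (f (v ++ [c, a, b] ++ t)).toNat =
      (f (v ++ [b, c, a] ++ t)).toNat + (f (v ++ [a, c, b] ++ t)).toNat := by
  have key : ∀ x, (x = [b, a, c] ∨ x = [c, a, b] ∨ x = [b, c, a] ∨ x = [a, c, b]) →
      x.Perm [b, a, c] → f (v ++ x ++ t) = true →
      (f (v ++ [b, a, c] ++ t)).toNat + (f (v ++ [c, a, b] ++ t)).toNat =
        (f (v ++ [b, c, a] ++ t)).toNat + (f (v ++ [a, c, b] ++ t)).toNat := by
    intro x hx hxp hfx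
    have h := hf _ ((((List.Perm.refl v).append hxp).append_right t).trans hp) hfx
    rw [List.append_assoc] at h
    have h' := balSquare_of_balWord hab hbc hx (balWord_append h)
    simp only [balSquare, Nat.beq_eq, List.reverseAux_eq, List.append_nil, List.reverse_reverse] at h'
    simpa using h'
  by_cases h1 : f (v ++ [b, a, c] ++ t) = true
  · exact key _ (by simp) (List.Perm.refl _) h1
  by_cases h2 : f (v ++ [c, a, b] ++ t) = true
  · refine key _ (by simp) ?_ h2
    exact (List.Perm.swap a c [b]).trans (((List.Perm.swap b c []).cons a).trans (.swap b a [c]))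
  by_cases h3 : f (v ++ [b, c, a] ++ t) = true
  · exact key _ (by simp) ((List.Perm.swap a c []).cons b) h3
  by_cases h4 : f (v ++ [a, c, b] ++ t) = true
  · exact key _ (by simp) (((List.Perm.swap b c []).cons a).trans (.swap b a [c])) h4
  simp only [h1, h2, h3, h4]

theorem perm_square {N : ℕ} (v t : List (Fin N)) (a b c : Fin N) :
    (v ++ [c, a, b] ++ t ∈ permWords N ↔ v ++ [b, a, c] ++ t ∈ permWords N) ∧
    (v ++ [b, c, a] ++ t ∈ permWords N ↔ v ++ [b, a, c] ++ t ∈ permWords N) ∧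
    (v ++ [a, c, b] ++ t ∈ permWords N ↔ v ++ [b, a, c] ++ t ∈ permWords N) := by
  have key : ∀ x : List (Fin N), x.Perm [b, a, c] →
      (v ++ x ++ t ∈ permWords N ↔ v ++ [b, a, c] ++ t ∈ permWords N) := by
    intro x hx
    have h := ((List.Perm.refl v).append hx).append_right t
    rw [mem_permWords, mem_permWords, h.length_eq, h.nodup_iff]
  exact ⟨key _ ((List.Perm.swap a c [b]).trans
      (((List.Perm.swap b c []).cons a).trans (.swap b a [c]))),
    key _ ((List.Perm.swap a c []).cons b),
    key _ (((List.Perm.swap b c []).cons a).trans (.swap b a [c]))⟩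

/-- The three parts are pairwise disjoint, so at most one of the subtracted terms is 1. -/
theorem indicator_Wbar {w : List (Fin 8)} (hw : w ∈ permWords 8) :
    (if w ∈ Wbar then 1 else 0 : ℤ) = 1 - ((inKnuth (w.map Fin.val)).toNat +
      (in3 (w.map Fin.val)).toNat + (in7 (w.map Fin.val)).toNat : ℕ) := by
  have hp := perm_letters8 hw
  have hK := fun h => test_of_countAcc_eq_zero countAcc_knuth hp (isSome_run_of_inKnuth h) h
  have h3 := fun h => test_of_countAcc_eq_zero countAcc_3 hp (isSome_run_of_in3 h) h
  rw [Wbar]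
  simp only [Finset.mem_sdiff, hw, true_and, mem_Wstar]
  cases h1 : inKnuth (w.map Fin.val) <;> cases h2 : in3 (w.map Fin.val) <;>
    cases h4 : in7 (w.map Fin.val) <;> simp_all

/-- A square lies in `S_8` entirely or not at all. In the first case the indicator is the constant 1
minus three balanced functions; in the second it vanishes. -/
theorem balanced_Wbar : Balanced Wbar := by
  intro v t a b c hab hbc
  obtain ⟨e1, e2, e3⟩ := perm_square v t a b c
  by_cases hw : v ++ [b, a, c] ++ t ∈ permWords 8
  · rw [indicator_Wbar hw, indicator_Wbar (e1.2 hw), indicator_Wbar (e2.2 hw),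
      indicator_Wbar (e3.2 hw)]
    have hp := perm_letters8 hw
    simp only [List.map_append, List.map_cons, List.map_nil] at hp ⊢
    have hK := toNat_balanced (fun w hw h => by
      have := test_of_countAcc_eq_zero countAcc_knuth hw (isSome_run_of_inKnuth h) h
      simp only [Bool.and_eq_true] at this
      exact this.1.1) _ _ hab hbc hp
    have h3 := toNat_balanced (fun w hw h => by
      have := test_of_countAcc_eq_zero countAcc_3 hw (isSome_run_of_in3 h) h
      simp only [Bool.and_eq_true] at this
      exact this.1) _ _ hab hbc hp
    have h7 := toNat_balanced (fun w hw h =>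
      test_of_countAcc_eq_zero countAcc_7 hw (isSome_run_of_in7 h) h) _ _ hab hbc hp
    omega
  · have key : ∀ w ∉ permWords 8, w ∉ Wbar := fun w hw h => hw (Finset.mem_sdiff.1 h).1
    rw [if_neg (key _ hw), if_neg (key _ (mt e1.1 hw)), if_neg (key _ (mt e2.1 hw)),
      if_neg (key _ (mt e3.1 hw))]

/-! ### Counting words with a prescribed possible nondescent. -/

theorem stepDecr_eq (d : ℕ) (p : List ℕ) (x : ℕ) : stepDecr d [p] x =
    -- The default `x + 1` lets the first letter of a word pass.
    if p.length = d ∨ x < p.headD (x + 1) then some [x :: p] else none := by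
  show (Bool.rec none (some [x :: p]) (Bool.rec (Nat.ble (Nat.succ x) (p.headD (Nat.succ x))) true
      (Nat.beq p.length d)) : Option (List (List ℕ))) = _
  have h1 : Nat.beq p.length d = decide (p.length = d) := by
    rw [Bool.eq_iff_iff, Nat.beq_eq, decide_eq_true_iff]
  have h2 : Nat.ble (Nat.succ x) (p.headD (Nat.succ x)) = decide (x < p.headD (x + 1)) := by
    rw [Bool.eq_iff_iff, Nat.ble_eq, decide_eq_true_iff, Nat.succ_le_iff]
  rw [h1, h2]
  by_cases h : p.length = d <;> by_cases h' : x < p.headD (x + 1) <;> simp only [h, h'] <;> rfl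

theorem isSome_run_stepDecr_cons (d : ℕ) (m : List ℕ) (y : ℕ) (q : List ℕ) :
    (run (stepDecr d) m [y :: q]).isSome ↔ ∀ (j : ℕ) (h : j + 1 < (y :: m).length),
      j + 1 + q.length ≠ d → (y :: m)[j + 1] < (y :: m)[j] := by
  induction m generalizing y q with
  | nil => simp
  | cons x m ih =>
    rw [run_cons, stepDecr_eq]
    have key : (∀ (j : ℕ) (h : j + 1 < (y :: x :: m).length),
        j + 1 + q.length ≠ d → (y :: x :: m)[j + 1] < (y :: x :: m)[j]) ↔
        ((y :: q).length = d ∨ x < y) ∧ ∀ (j : ℕ) (h : j + 1 < (x :: m).length),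
          j + 1 + (y :: q).length ≠ d → (x :: m)[j + 1] < (x :: m)[j] := by
      constructor
      · refine fun h => ⟨?_, fun j hj hd => ?_⟩
        · have := h 0 (by simp)
          simp only [List.length_cons]
          by_contra hc
          simp only [not_or] at hc
          exact hc.2 (this (by omega))
        · have := h (j + 1) (by simpa using hj)
          exact this (by rw [List.length_cons] at hd; omega)
      · rintro ⟨h1, h2⟩ j hj hd
        cases j with
        | zero =>
          rcases h1 with h1 | h1
          · rw [List.length_cons] at h1
            omega
          · exact h1
        | succ j => exact h2 j (by simpa using hj) (by rw [List.length_cons]; omega)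
    rw [key, List.headD_cons]
    by_cases h : (y :: q).length = d ∨ x < y
    · rw [if_pos h, Option.bind_some, ih, and_iff_right h]
    · rw [if_neg h, Option.bind_none]
      exact iff_of_false (by simp) fun h' => h h'.1

theorem isSome_run_stepDecr {N : ℕ} (d : ℕ) (w : List (Fin N)) :
    (run (stepDecr d) (w.map Fin.val) [[]]).isSome ↔ DecrExcept d w := by
  cases w with
  | nil => simp [DecrExcept]
  | cons x w =>
    rw [List.map_cons, run_cons, stepDecr_eq, if_pos (by simp), Option.bind_some,
      isSome_run_stepDecr_cons, DecrExcept]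
    simp only [← List.map_cons, List.getElem_map, List.length_map, List.length_nil, add_zero,
      Fin.val_fin_lt]

open Classical in
theorem card_Wbar_filter (d : ℕ) : (Wbar.filter (DecrExcept d)).card =
    countAcc (stepDecr d) (testRev (fun _ => true) fun w => inKnuth w || in3 w || in7 w)
      8 letters8 [[]] [] := by
  rw [← card_filter_run _ _ _ _ _ _ (by decide) (by rfl)]
  have hmem : ∀ w : List (Fin 8), w ∈ permWords 8 → ((run (stepDecr d) (w.map Fin.val) [[]]).isSome ∧
      testRev (fun _ => true) (fun w => inKnuth w || in3 w || in7 w)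
        ((w.map Fin.val).reverse ++ []) = true ↔ w ∈ Wbar ∧ DecrExcept d w) := by
    intro w hw
    rw [isSome_run_stepDecr, testRev_reverse, Wbar, Finset.mem_sdiff, mem_Wstar, and_comm]
    simp [hw, and_assoc]
  refine Finset.card_bij (fun w _ => w.map Fin.val) ?_ ?_ ?_
  · intro w hw
    have hw := Finset.mem_filter.1 hw
    have hp : w ∈ permWords 8 := (Finset.mem_sdiff.1 hw.1).1
    exact Finset.mem_filter.2 ⟨List.mem_toFinset.2 (List.mem_permutations.2 (perm_letters8 hp)),
      (hmem w hp).2 hw⟩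
  · intro w _ w' _ h
    exact List.map_injective_iff.2 Fin.val_injective h
  · intro m hm
    have hm := Finset.mem_filter.1 hm
    have hp : m.Perm letters8 := List.mem_permutations.1 (List.mem_toFinset.1 hm.1)
    have hlt : ∀ x ∈ m, x < 8 := by
      intro x hx
      have : ∀ y ∈ letters8, y < 8 := by decide
      exact this x (hp.subset hx)
    obtain ⟨w, rfl⟩ : ∃ w : List (Fin 8), w.map Fin.val = m :=
      ⟨m.pmap (fun x h => ⟨x, h⟩) hlt, by simp [List.map_pmap]⟩
    have hw : w ∈ permWords 8 := mem_permWords.2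
      ⟨(List.length_map _).symm.trans hp.length_eq, List.Nodup.of_map Fin.val (hp.nodup_iff.2 (by decide))⟩
    exact ⟨w, Finset.mem_filter.2 ((hmem w hw).1 hm.2), rfl⟩

/-! ### D₀ graphs on balanced sets -/

/-- Here `p, q, r, s` stand for bac, bca, acb, cab. Balance leaves six of the sixteen membership
patterns: none, one of `p, s` with one of `q, r`, or all four. Each such pair is an allowed edge,
and in the full square the last condition selects the Knuth pairs. -/
theorem existsUnique_partner {α : Type*} [DecidableEq α] (W : Finset α) {p q r s : α}
    (hpq : p ≠ q) (hpr : p ≠ r) (hps : p ≠ s) (hqr : q ≠ r) (hqs : q ≠ s) (hrs : r ≠ s)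
    (hb : (if p ∈ W then 1 else 0) + (if s ∈ W then 1 else 0) =
      (if q ∈ W then 1 else 0) + (if r ∈ W then (1 : ℤ) else 0))
    {x : α} (hx : x ∈ W) (hx' : x = p ∨ x = q ∨ x = r ∨ x = s) :
    ∃! y, y ∈ W ∧
      ((x = p ∧ y = q ∨ x = r ∧ y = s ∨ x = p ∧ y = r ∨ x = q ∧ y = s) ∨
        (y = p ∧ x = q ∨ y = r ∧ x = s ∨ y = p ∧ x = r ∨ y = q ∧ x = s)) ∧
      (p ∈ W → q ∈ W → r ∈ W → s ∈ W →
        (x = p ∧ y = q ∨ x = r ∧ y = s) ∨ (y = p ∧ x = q ∨ y = r ∧ x = s)) := by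
  by_cases h1 : p ∈ W <;> by_cases h2 : q ∈ W <;> by_cases h3 : r ∈ W <;> by_cases h4 : s ∈ W <;>
    simp only [h1, h2, h3, h4, if_true, if_false] at hb <;> norm_num at hb <;>
    rcases hx' with rfl | rfl | rfl | rfl <;>
    first
    | contradiction
    | exact ⟨q, by grind, by grind⟩
    | exact ⟨p, by grind, by grind⟩
    | exact ⟨r, by grind, by grind⟩
    | exact ⟨s, by grind, by grind⟩

/-- The three letters after a prefix of given length determine `a, b, c` by sorting. Hence a word
lies in only one square of each colour, and partners found in different squares cannot compete. -/
theorem krSquare_inj {N : ℕ} {v v' t t' : List (Fin N)} {a b c a' b' c' : Fin N} (hab : a < b)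
    (hbc : b < c) (hab' : a' < b') (hbc' : b' < c') (hv : v.length = v'.length)
    {x : List (Fin N)} (hx : x ∈ krSquare v t a b c) (hx' : x ∈ krSquare v' t' a' b' c') :
    v = v' ∧ t = t' ∧ a = a' ∧ b = b' ∧ c = c' := by
  have key : ∀ y y' : List (Fin N), y.length = 3 → y'.length = 3 → v ++ y ++ t = v' ++ y' ++ t' →
      v = v' ∧ y = y' ∧ t = t' := by
    intro y y' hy hy' h
    rw [List.append_assoc, List.append_assoc] at h
    obtain ⟨h1, h2⟩ := List.append_inj h hv
    exact ⟨h1, List.append_inj h2 (hy.trans hy'.symm)⟩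
  have hac := hab.trans hbc
  have hac' := hab'.trans hbc'
  rcases hx with rfl | rfl | rfl | rfl <;> rcases hx' with h | h | h | h <;>
    obtain ⟨h1, h2, h3⟩ := key _ _ rfl rfl h <;>
    simp only [List.cons.injEq, and_true] at h2 <;>
    obtain ⟨rfl, rfl, rfl⟩ := h2 <;>
    first
    | exact ⟨h1, h3, rfl, rfl, rfl⟩
    | exact absurd hab hab'.asymm
    | exact absurd hbc hbc'.asymm
    | exact absurd hac hac'.asymm
    | exact absurd hab hbc'.asymm
    | exact absurd hbc hab'.asymm
    | exact absurd hac hbc'.asymm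
    | exact absurd hac hab'.asymm

/-- `{x, y}` is one of the two Knuth pairs of a square, in this order of `x` and `y`. -/
def IsKnuthPair {N : ℕ} (v t : List (Fin N)) (a b c : Fin N) (x y : List (Fin N)) : Prop :=
  (x = v ++ [b, a, c] ++ t ∧ y = v ++ [b, c, a] ++ t) ∨
  (x = v ++ [a, c, b] ++ t ∧ y = v ++ [c, a, b] ++ t)

theorem IsKRPair.mem_krSquare {N : ℕ} {v t : List (Fin N)} {a b c : Fin N} {x y : List (Fin N)}
    (h : IsKRPair v t a b c x y) : x ∈ krSquare v t a b c ∧ y ∈ krSquare v t a b c := by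
  rcases h with ⟨rfl, rfl⟩ | ⟨rfl, rfl⟩ | ⟨rfl, rfl⟩ | ⟨rfl, rfl⟩ <;> simp [krSquare]

theorem IsKRPair.ne {N : ℕ} {v t : List (Fin N)} {a b c : Fin N} {x y : List (Fin N)}
    (hab : a < b) (hbc : b < c) (h : IsKRPair v t a b c x y) : x ≠ y := by
  rcases h with ⟨rfl, rfl⟩ | ⟨rfl, rfl⟩ | ⟨rfl, rfl⟩ | ⟨rfl, rfl⟩ <;>
    simp [hab.ne, hab.ne', hbc.ne, hbc.ne', (hab.trans hbc).ne', (hab.trans hbc).ne]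

/-- The adjacency relation joining the words of `W` in each square, by Knuth pairs if the whole
square is contained in `W`. -/
def SquareAdj {N : ℕ} (W : Finset (List (Fin N))) (i : ℕ) (x y : List (Fin N)) : Prop :=
  x ∈ W ∧ y ∈ W ∧ ∃ (v t : List (Fin N)) (a b c : Fin N), v.length + 2 = i ∧ a < b ∧ b < c ∧
    (IsKRPair v t a b c x y ∨ IsKRPair v t a b c y x) ∧
    (krSquare v t a b c ⊆ W → IsKnuthPair v t a b c x y ∨ IsKnuthPair v t a b c y x)

/-- The graph of `SquareAdj`. -/
def squareGraph {N : ℕ} (W : Finset (List (Fin N))) (i : ℕ) : SimpleGraph (List (Fin N)) where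
  Adj := SquareAdj W i
  symm := ⟨fun _ _ ⟨hx, hy, v, t, a, b, c, hv, hab, hbc, h, h'⟩ =>
    ⟨hy, hx, v, t, a, b, c, hv, hab, hbc, h.symm, fun hs => (h' hs).symm⟩⟩
  loopless := ⟨fun _ ⟨_, _, _, _, _, _, _, _, hab, hbc, h, _⟩ =>
    h.elim (fun h => h.ne hab hbc rfl) fun h => h.ne hab hbc rfl⟩

theorem squareAdj_iff {N : ℕ} {W : Finset (List (Fin N))} {v t : List (Fin N)} {a b c : Fin N}
    (hab : a < b) (hbc : b < c) {x : List (Fin N)} (hx : x ∈ W)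
    (hxs : x ∈ krSquare v t a b c) (y : List (Fin N)) :
    SquareAdj W (v.length + 2) x y ↔ y ∈ W ∧
      (IsKRPair v t a b c x y ∨ IsKRPair v t a b c y x) ∧
      (krSquare v t a b c ⊆ W → IsKnuthPair v t a b c x y ∨ IsKnuthPair v t a b c y x) := by
  constructor
  · rintro ⟨_, hy, v', t', a', b', c', hv, hab', hbc', h, h'⟩
    have hxs' : x ∈ krSquare v' t' a' b' c' :=
      h.elim (fun h => h.mem_krSquare.1) fun h => h.mem_krSquare.2
    obtain ⟨rfl, rfl, rfl, rfl, rfl⟩ := krSquare_inj hab hbc hab' hbc' (by omega) hxs hxs'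
    exact ⟨hy, h, h'⟩
  · rintro ⟨hy, h, h'⟩
    exact ⟨hx, hy, v, t, a, b, c, rfl, hab, hbc, h, h'⟩

theorem existsUnique_squareAdj {N : ℕ} {W : Finset (List (Fin N))} (hb : Balanced W)
    {v t : List (Fin N)} {a b c : Fin N} (hab : a < b) (hbc : b < c) {x : List (Fin N)}
    (hx : x ∈ W) (hxs : x ∈ krSquare v t a b c) : ∃! y, SquareAdj W (v.length + 2) x y := by
  have h1 := hab.ne
  have h2 := hab.ne'
  have h3 := hbc.ne
  have h4 := hbc.ne'
  have h5 := (hab.trans hbc).ne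
  have h6 := (hab.trans hbc).ne'
  have hW : (krSquare v t a b c ⊆ W) ↔ v ++ [b, a, c] ++ t ∈ W ∧ v ++ [b, c, a] ++ t ∈ W ∧
      v ++ [a, c, b] ++ t ∈ W ∧ v ++ [c, a, b] ++ t ∈ W := by
    simp only [krSquare, Set.insert_subset_iff, Set.singleton_subset_iff, Finset.mem_coe]
  simp only [squareAdj_iff hab hbc hx hxs, hW, and_imp, IsKRPair, IsKnuthPair]
  refine existsUnique_partner W ?_ ?_ ?_ ?_ ?_ ?_ (hb v t a b c hab hbc) hx hxs <;>
    simp [h1, h2, h3, h4, h5, h6]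

theorem exists_D0Graph {N n : ℕ} {W : Finset (List (Fin N))} (hW : ∀ w ∈ W, IsStdWord n w)
    (hb : Balanced W) : ∃ G : D0Graph N n, G.verts = W :=
  ⟨{ verts := W
     verts_std := hW
     edge := squareGraph W
     edge_mem := fun _ _ _ h => ⟨h.1, h.2.1⟩
     edge_color := fun i x y ⟨hx, _, v, t, a, b, c, hv, _, _, h, _⟩ => by
      have hlen : x.length = v.length + 3 + t.length := by
        rcases h with (h | h | h | h) | (h | h | h | h) <;> simp [h.1, h.2] <;> omega
      have := (hW x hx).1
      omega
     edge_type := fun _ _ _ ⟨_, _, v, t, a, b, c, hv, hab, hbc, h, _⟩ =>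
      ⟨v, t, a, b, c, hv, hab, hbc, h⟩
     edge_unique := fun _ _ _ _ _ hab hbc _ hx hxs => existsUnique_squareAdj hb hab hbc hx hxs },
    rfl⟩

/-! ### The bilinear form -/

theorem pairing_zero {N : ℕ} (g : U N) : pairing 0 g = 0 := Finsupp.sum_zero_index

/-- The pairing with a fixed element. -/
def pairingHom {N : ℕ} (g : U N) : U N →+ ℤ where
  toFun f := pairing f g
  map_zero' := Finsupp.sum_zero_index
  map_add' f f' := Finsupp.sum_add_index' (by simp) (by simp [add_mul])

theorem pairing_single {N : ℕ} (w : FreeMonoid (Fin N)) (r : ℤ) (g : U N) :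
    pairing (MonoidAlgebra.single w r) g = r * g.coeff w := by
  rw [pairing, MonoidAlgebra.coeff_single, Finsupp.sum_single_index (by simp)]

theorem coeff_wordSum {N : ℕ} (W : Finset (List (Fin N))) (w : FreeMonoid (Fin N)) :
    (wordSum W).coeff w = if w.toList ∈ W then 1 else 0 := by
  classical
  rw [wordSum, MonoidAlgebra.coeff_sum, Finsupp.finsetSum_apply]
  simp only [mono, MonoidAlgebra.coeff_single, Finsupp.single_apply]
  rw [← Finset.sum_ite_eq' W w.toList fun _ => (1 : ℤ)]
  refine Finset.sum_congr rfl fun v _ => ?_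
  congr 1

theorem pairing_mul_mono_mul {N : ℕ} (W : Finset (List (Fin N))) (v t : FreeMonoid (Fin N))
    (r r' : ℤ) (w : List (Fin N)) :
    pairing (MonoidAlgebra.single v r * mono w * MonoidAlgebra.single t r') (wordSum W) =
      r * r' * if v.toList ++ w ++ t.toList ∈ W then 1 else 0 := by
  rw [mono, MonoidAlgebra.single_mul_single, MonoidAlgebra.single_mul_single, pairing_single,
    coeff_wordSum, mul_one]
  rfl

theorem wordSum_mem_perp {N : ℕ} {W : Finset (List (Fin N))} (hW : ∀ w ∈ W, w.Nodup)
    (hb : Balanced W) : wordSum W ∈ perp (idealKR N) := by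
  -- Vanishing on `z` alone does not pass to its multiples, so the induction over the ideal carries
  -- arbitrary factors on both sides.
  suffices h : ∀ z ∈ idealKR N, ∀ u v : U N, pairing (u * z * v) (wordSum W) = 0 by
    intro z hz
    simpa using h z hz 1 1
  intro z hz
  refine TwoSidedIdeal.span_induction (p := fun z _ => ∀ u v : U N,
    pairing (u * z * v) (wordSum W) = 0) ?_ ?_ ?_ ?_ ?_ ?_ hz
  · intro z hz u v
    have add := (pairingHom (wordSum W)).map_add
    have sub := (pairingHom (wordSum W)).map_sub
    change ∀ f g, pairing (f + g) _ = pairing f _ + pairing g _ at add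
    change ∀ f g, pairing (f - g) _ = pairing f _ - pairing g _ at sub
    induction u using MonoidAlgebra.induction_linear with
    | zero => simp [pairing_zero]
    | add u u' hu hu' => rw [add_mul, add_mul, add, hu, hu', add_zero]
    | single x r =>
    induction v using MonoidAlgebra.induction_linear with
    | zero => simp [pairing_zero]
    | add v v' hv hv' => rw [mul_add, add, hv, hv', add_zero]
    | single y r' =>
    rcases hz with ⟨a, b, c, hab, hbc, rfl⟩ | ⟨w, hw, rfl⟩
    · have e : var b * (var a * var c - var c * var a) - (var a * var c - var c * var a) * var b =
          mono [b, a, c] - mono [b, c, a] - (mono [a, c, b] - mono [c, a, b]) := by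
        have h3 : ∀ a b c : Fin N, mono [a, b, c] = var a * (var b * var c) := by
          intro a b c
          rw [var, var, var, mono, mono, mono, mono, MonoidAlgebra.single_mul_single,
            MonoidAlgebra.single_mul_single]
          rfl
        rw [h3, h3, h3, h3]
        simp only [mul_sub, sub_mul, mul_assoc]
      rw [e]
      simp only [mul_sub, sub_mul, sub, pairing_mul_mono_mul]
      have := hb x.toList y.toList a b c hab hbc
      rw [← mul_sub, ← mul_sub, ← mul_sub]
      exact mul_eq_zero_of_right _ (by omega)
    · rw [pairing_mul_mono_mul, if_neg, mul_zero]
      exact fun h => hw (((List.nodup_append.1 (List.nodup_append.1 (hW _ h)).1)).2.1)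
  · intro u v
    simp [pairing_zero]
  · intro x y _ _ hx hy u v
    rw [mul_add, add_mul]
    exact ((pairingHom (wordSum W)).map_add _ _).trans (by
      show pairing _ _ + pairing _ _ = 0
      rw [hx, hy, add_zero])
  · intro x _ hx u v
    rw [mul_neg, neg_mul]
    exact ((pairingHom (wordSum W)).map_neg _).trans (by
      show -pairing _ _ = 0
      rw [hx, neg_zero])
  · intro a x _ hx u v
    rw [← mul_assoc]
    exact hx _ _
  · intro a x _ hx u v
    rw [← mul_assoc, mul_assoc]
    exact hx _ _

/-! ### The noncommutative Schur function -/

theorem ncSchur_eq {N : ℕ} {μ : YoungDiagram} {t : ℕ} (h : μ.rowLen 0 = t) : ncSchur N μ =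
    ∑ π : Equiv.Perm (Fin t), (Equiv.Perm.sign π : ℤ) • (List.ofFn fun i : Fin t =>
      ncElem N ((μ.colLen i : ℤ) + ((π i : ℕ) : ℤ) - ((i : ℕ) : ℤ))).prod := by
  subst h
  rfl

/-- Both columns have length 4; the transposition shifts the indices to 5 and 3. -/
theorem ncSchur_shape2222 (N : ℕ) :
    ncSchur N shape2222 = ncElem N 4 * ncElem N 4 - ncElem N 5 * ncElem N 3 := by
  have h : shape2222.rowLen 0 = 2 := by
    rw [YoungDiagram.rowLen_eq_card]
    decide
  have h0 : shape2222.colLen 0 = 4 := by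
    rw [YoungDiagram.colLen_eq_card]
    decide
  have h1 : shape2222.colLen 1 = 4 := by
    rw [YoungDiagram.colLen_eq_card]
    decide
  rw [ncSchur_eq h, show (Finset.univ : Finset (Equiv.Perm (Fin 2))) = {1, Equiv.swap 0 1} by decide,
    Finset.sum_pair (by decide)]
  simp [h0, h1, List.ofFn_succ, sub_eq_add_neg]

theorem decrExcept_iff {N : ℕ} {d : ℕ} {w : List (Fin N)} (hd : d ≤ w.length) : DecrExcept d w ↔
    (w.take d).Pairwise (· > ·) ∧ (w.drop d).Pairwise (· > ·) := by
  rw [← List.isChain_iff_pairwise, ← List.isChain_iff_pairwise, List.isChain_iff_getElem,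
    List.isChain_iff_getElem, DecrExcept]
  simp only [List.getElem_take, List.getElem_drop, List.length_take, List.length_drop]
  constructor
  · exact fun h => ⟨fun j hj => h j (by omega) (by omega), fun j hj => h (d + j) (by omega) (by omega)⟩
  · rintro ⟨h1, h2⟩ j hj hjd
    rcases lt_or_ge (j + 1) d with h | h
    · exact h1 j (by omega)
    · obtain ⟨k, rfl⟩ := Nat.exists_eq_add_of_le (show d ≤ j by omega)
      exact h2 k (by omega)

-- A word of length `d + d'` factors in at most one way into strictly decreasing words of lengths
-- `d` and `d'`, and it does so exactly when it decreases except perhaps at the cut.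
open Classical in
theorem pairing_ncElem_mul {N d d' : ℕ} {W : Finset (List (Fin N))}
    (hW : ∀ w ∈ W, w.length = d + d' ∧ w.Nodup) :
    pairing (ncElem N d * ncElem N d') (wordSum W) = (W.filter (DecrExcept d)).card := by
  have hn : ∀ d : ℕ, ncElem N d = ∑ S ∈ (Finset.univ : Finset (Fin N)).powersetCard d,
      mono (S.sort (· ≥ ·)) := fun d => if_neg (by omega)
  rw [hn, hn, Finset.sum_mul_sum, ← Finset.sum_product']
  refine (map_sum (pairingHom (wordSum W)) _ _).trans ?_
  have : ∀ x : Finset (Fin N) × Finset (Fin N), pairingHom (wordSum W)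
      (mono (x.1.sort (· ≥ ·)) * mono (x.2.sort (· ≥ ·))) =
      if x.1.sort (· ≥ ·) ++ x.2.sort (· ≥ ·) ∈ W then 1 else 0 := by
    intro x
    show pairing _ _ = _
    rw [mono, mono, MonoidAlgebra.single_mul_single, pairing_single, coeff_wordSum]
    simp
  rw [Finset.sum_congr rfl fun x _ => this x, Finset.sum_boole, Nat.cast_inj]
  refine Finset.card_bij (fun x _ => x.1.sort (· ≥ ·) ++ x.2.sort (· ≥ ·)) ?_ ?_ ?_
  · rintro ⟨S, T⟩ h
    simp only [Finset.mem_filter, Finset.mem_product, Finset.mem_powersetCard] at h ⊢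
    refine ⟨h.2, (decrExcept_iff (by simp [h.1.1.2])).2 ?_⟩
    rw [List.take_left' (by simp [h.1.1.2]), List.drop_left' (by simp [h.1.1.2])]
    exact ⟨(Finset.sortedGT_sort S).pairwise, (Finset.sortedGT_sort T).pairwise⟩
  · rintro ⟨S, T⟩ h ⟨S', T'⟩ h' e
    simp only [Finset.mem_filter, Finset.mem_product, Finset.mem_powersetCard] at h h' e
    obtain ⟨e1, e2⟩ := List.append_inj e (by simp [h.1.1.2, h'.1.1.2])
    rw [← Finset.sort_toFinset S (· ≥ ·), ← Finset.sort_toFinset T (· ≥ ·), e1, e2,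
      Finset.sort_toFinset, Finset.sort_toFinset]
  · intro w hw
    have hw := Finset.mem_filter.1 hw
    obtain ⟨hlen, hnd⟩ := hW w hw.1
    obtain ⟨h1, h2⟩ := (decrExcept_iff (by omega)).1 hw.2
    have n1 : (w.take d).Nodup := hnd.sublist (List.take_sublist _ _)
    have n2 : (w.drop d).Nodup := hnd.sublist (List.drop_sublist _ _)
    have e1 := (List.toFinset_sort (· ≥ ·) n1).2 (h1.imp fun h => h.le)
    have e2 := (List.toFinset_sort (· ≥ ·) n2).2 (h2.imp fun h => h.le)
    refine ⟨((w.take d).toFinset, (w.drop d).toFinset), ?_, ?_⟩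
    · simp only [Finset.mem_filter, Finset.mem_product, Finset.mem_powersetCard, e1, e2,
        List.take_append_drop, hw.1, Finset.subset_univ, true_and, and_true,
        List.toFinset_card_of_nodup n1, List.toFinset_card_of_nodup n2, List.length_take,
        List.length_drop]
      omega
    · simp only [e1, e2, List.take_append_drop]

theorem mem_Wbar {w : List (Fin 8)} (hw : w ∈ Wbar) : w.length = 8 ∧ w.Nodup :=
  mem_permWords.1 (Finset.mem_sdiff.1 hw).1

theorem pairing_ncSchur_fstar : pairing (ncSchur 8 shape2222) fstar = -1 := by
  have h4 := pairing_ncElem_mul (d := 4) (d' := 4) fun w hw => mem_Wbar hw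
  have h5 := pairing_ncElem_mul (d := 5) (d' := 3) fun w hw => mem_Wbar hw
  rw [card_Wbar_filter, countAcc_decr4] at h4
  rw [card_Wbar_filter, countAcc_decr5] at h5
  rw [ncSchur_shape2222]
  refine ((pairingHom fstar).map_sub _ _).trans ?_
  show pairing _ _ - pairing _ _ = -1
  rw [fstar]
  exact (congrArg₂ (· - ·) h4 h5).trans (by norm_num)

/-! ### Schur functions as sums of fundamental quasisymmetric functions -/

/-- Standard tableaux of shape `μ` with `n` cells, as enumerations of the cells. -/
def StdTab (μ : YoungDiagram) (n : ℕ) : Type :=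
  {p : Fin n ≃ μ.cells // ∀ i j, (p i).1 ≤ (p j).1 → i ≤ j}

instance (μ : YoungDiagram) (n : ℕ) : Finite (StdTab μ n) :=
  inferInstanceAs (Finite {p : Fin n ≃ μ.cells // ∀ i j, (p i).1 ≤ (p j).1 → i ≤ j})

instance (μ : YoungDiagram) (n : ℕ) : Fintype (StdTab μ n) := Fintype.ofFinite _

/-- The descents of a standard tableau: the next cell is weakly to the left. -/
def StdTab.descents {μ : YoungDiagram} {n : ℕ} (p : StdTab μ n) : Set ℕ :=
  {j | ∃ h : j + 1 < n, (p.1 ⟨j + 1, h⟩).1.2 ≤ (p.1 ⟨j, Nat.lt_of_succ_lt h⟩).1.2}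

/-- The weakly increasing sequences of length `n` that increase strictly at `D`. -/
def Compatible (n : ℕ) (D : Set ℕ) (s : Fin n → ℕ) : Prop :=
  Monotone s ∧ ∀ (j : ℕ) (h : j + 1 < n), j ∈ D → s ⟨j, Nat.lt_of_succ_lt h⟩ < s ⟨j + 1, h⟩

variable {μ : YoungDiagram} {n : ℕ}

/-- Between `a` and `b` the sequence is constant, so no position there is a descent and each step
goes strictly to the right. -/
theorem StdTab.col_lt (p : StdTab μ n) {s : Fin n → ℕ} (hs : Compatible n p.descents s)
    {a b : Fin n} (hab : a < b) (h : s a = s b) : (p.1 a).1.2 < (p.1 b).1.2 := by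
  obtain ⟨a, ha⟩ := a
  obtain ⟨b, hb⟩ := b
  replace hab : a + 1 ≤ b := hab
  have step : ∀ j (hj : j + 1 < n), s ⟨j, Nat.lt_of_succ_lt hj⟩ = s ⟨j + 1, hj⟩ →
      (p.1 ⟨j, Nat.lt_of_succ_lt hj⟩).1.2 < (p.1 ⟨j + 1, hj⟩).1.2 := by
    intro j hj e
    by_contra hc
    exact (hs.2 j hj ⟨hj, not_lt.1 hc⟩).ne e
  induction b, hab using Nat.le_induction with
  | base => exact step a hb h
  | succ b hab ih =>
    have h1 : s ⟨a, ha⟩ ≤ s ⟨b, Nat.lt_of_succ_lt hb⟩ := hs.1 (by rw [Fin.mk_le_mk]; omega)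
    have h2 : s ⟨b, Nat.lt_of_succ_lt hb⟩ ≤ s ⟨b + 1, hb⟩ := hs.1 (by simp)
    exact (ih _ (h1.antisymm (h2.trans h.ge))).trans (step b hb (h2.antisymm (h.ge.trans h1)))

/-- The semistandard tableau of a standard tableau and a compatible sequence. -/
def StdTab.toSSYT (p : StdTab μ n) (s : Fin n → ℕ) (hs : Compatible n p.descents s) :
    SemistandardYoungTableau μ where
  entry r c := if h : (r, c) ∈ μ.cells then s (p.1.symm ⟨(r, c), h⟩) else 0
  row_weak' {r c c'} hc h := by
    have h' : (r, c) ∈ μ := μ.up_left_mem le_rfl hc.le h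
    rw [dif_pos ((YoungDiagram.mem_cells _).2 h), dif_pos ((YoungDiagram.mem_cells _).2 h')]
    exact hs.1 (p.2 _ _ (by simpa using hc.le))
  col_strict' {r r' c} hr h := by
    have h' : (r, c) ∈ μ := μ.up_left_mem hr.le le_rfl h
    rw [dif_pos ((YoungDiagram.mem_cells _).2 h), dif_pos ((YoungDiagram.mem_cells _).2 h')]
    have hle : p.1.symm ⟨(r, c), (YoungDiagram.mem_cells _).2 h'⟩ ≤
        p.1.symm ⟨(r', c), (YoungDiagram.mem_cells _).2 h⟩ := p.2 _ _ (by simpa using hr.le)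
    have hne : p.1.symm ⟨(r, c), (YoungDiagram.mem_cells _).2 h'⟩ ≠
        p.1.symm ⟨(r', c), (YoungDiagram.mem_cells _).2 h⟩ := by simpa using hr.ne
    -- Equal entries would lie in strictly increasing columns, but these two cells share a column.
    refine lt_of_le_of_ne (hs.1 hle) fun e => ?_
    simpa using p.col_lt hs (lt_of_le_of_ne hle hne) e
  zeros' h := dif_neg h

theorem StdTab.toSSYT_apply (p : StdTab μ n) (s : Fin n → ℕ)
    (hs : Compatible n p.descents s) (j : Fin n) :
    p.toSSYT s hs (p.1 j).1.1 (p.1 j).1.2 = s j := by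
  show (if h : ((p.1 j).1.1, (p.1 j).1.2) ∈ μ.cells then
    s (p.1.symm ⟨((p.1 j).1.1, (p.1 j).1.2), h⟩) else 0) = s j
  rw [dif_pos (p.1 j).2]
  simp

/-- Cells are compared by their entries, then by their columns. -/
def cellKey (T : SemistandardYoungTableau μ) (z : μ.cells) : ℕ ×ₗ ℕ :=
  toLex (T z.1.1 z.1.2, z.1.2)

theorem cellKey_injective (T : SemistandardYoungTableau μ) : Function.Injective (cellKey T) := by
  rintro ⟨⟨r, c⟩, hz⟩ ⟨⟨r', c'⟩, hz'⟩ h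
  obtain ⟨h1, h2⟩ := Prod.ext_iff.1 (toLex.injective h)
  obtain rfl : c = c' := h2
  have h1 : T r c = T r' c := h1
  have hr : r = r' := by
    rcases lt_trichotomy r r' with hr | hr | hr
    · exact absurd h1 (T.col_strict hr hz').ne
    · exact hr
    · exact absurd h1 (T.col_strict hr hz).ne'
  subst hr
  rfl

theorem StdTab.strictMono_cellKey (p : StdTab μ n) (s : Fin n → ℕ)
    (hs : Compatible n p.descents s) : StrictMono (cellKey (p.toSSYT s hs) ∘ p.1) := by
  intro a b hab
  refine Prod.Lex.toLex_lt_toLex.2 ?_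
  simp only [toSSYT_apply]
  exact (hs.1 hab.le).lt_or_eq.imp_right fun h => ⟨h, p.col_lt hs hab h⟩

theorem StdTab.toSSYT_injective (p p' : StdTab μ n) (s s' : Fin n → ℕ)
    (hs : Compatible n p.descents s) (hs' : Compatible n p'.descents s')
    (h : p.toSSYT s hs = p'.toSSYT s' hs') : p = p' ∧ s = s' := by
  have h1 := p.strictMono_cellKey s hs
  have h2 := p'.strictMono_cellKey s' hs'
  rw [← h] at h2
  -- Both enumerations list the same keys in increasing order, so they coincide.
  have e := (StrictMono.range_inj h1 h2).1 (by rw [p.1.surjective.range_comp, p'.1.surjective.range_comp])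
  have hp : p = p' := Subtype.ext (Equiv.ext fun j => cellKey_injective _ (congrFun e j))
  subst hp
  refine ⟨rfl, funext fun j => ?_⟩
  rw [← p.toSSYT_apply s hs j, h, toSSYT_apply]

/-- This is standardization: the cells are listed by increasing entry, equal entries from left to
right. A step weakly to the left then forces a strict increase of the entry. -/
theorem StdTab.exists_toSSYT (hn : μ.card = n) (T : SemistandardYoungTableau μ) :
    ∃ (p : StdTab μ n) (s : Fin n → ℕ) (hs : Compatible n p.descents s),
      p.toSSYT s hs = T := by
  let e : Fin n ≃ μ.cells := (μ.cells.equivFinOfCardEq hn).symm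
  let p : Fin n ≃ μ.cells := (Tuple.sort (cellKey T ∘ e)).trans e
  have hmono : StrictMono (cellKey T ∘ p) :=
    (Tuple.monotone_sort (cellKey T ∘ e)).strictMono_of_injective
      ((cellKey_injective T).comp p.injective)
  have hlt : ∀ {a b : Fin n}, a < b → T (p a).1.1 (p a).1.2 < T (p b).1.1 (p b).1.2 ∨
      T (p a).1.1 (p a).1.2 = T (p b).1.1 (p b).1.2 ∧ (p a).1.2 < (p b).1.2 :=
    fun hab => Prod.Lex.toLex_lt_toLex.1 (hmono hab)
  have hp : ∀ i j, (p i).1 ≤ (p j).1 → i ≤ j := by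
    intro i j hij
    by_contra hc
    have h1 : T (p i).1.1 (p i).1.2 ≤ T (p j).1.1 (p j).1.2 :=
      (T.row_weak_of_le hij.2 (μ.up_left_mem hij.1 le_rfl (p j).2)).trans
        (T.col_weak hij.1 (p j).2)
    rcases hlt (not_le.1 hc) with h | h
    · exact h.not_ge h1
    · exact h.2.not_ge hij.2
  have hs : Compatible n (StdTab.descents ⟨p, hp⟩) fun j => T (p j).1.1 (p j).1.2 := by
    refine ⟨fun a b hab => ?_, fun j h hj => ?_⟩
    · rcases hab.lt_or_eq with hab | rfl
      · exact (hlt hab).elim le_of_lt fun h => h.1.le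
      · exact le_rfl
    · obtain ⟨_, hj⟩ := hj
      refine (hlt (Fin.mk_lt_mk.2 (Nat.lt_succ_self j))).resolve_right fun h' => ?_
      exact h'.2.not_ge hj
  refine ⟨⟨p, hp⟩, _, hs, SemistandardYoungTableau.ext fun r c => ?_⟩
  by_cases h : (r, c) ∈ μ.cells
  · obtain ⟨j, hj⟩ := p.surjective ⟨(r, c), h⟩
    have := StdTab.toSSYT_apply ⟨p, hp⟩ _ hs j
    simpa [hj] using this
  · exact (SemistandardYoungTableau.zeros _ h).trans (SemistandardYoungTableau.zeros _ h).symm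

theorem StdTab.sum_toSSYT (p : StdTab μ n) (s : Fin n → ℕ)
    (hs : Compatible n p.descents s) :
    ∑ z ∈ μ.cells, Finsupp.single (p.toSSYT s hs z.1 z.2) 1 =
      ∑ j, (Finsupp.single (s j) 1 : ℕ →₀ ℕ) := by
  rw [← Finset.sum_coe_sort, ← Equiv.sum_comp p.1]
  simp only [toSSYT_apply]

/-- The exponent of the monomial `x_{s 0} ⋯ x_{s (n-1)}`. -/
def content {n : ℕ} (s : Fin n → ℕ) : ℕ →₀ ℕ := ∑ j, Finsupp.single (s j) 1

theorem finite_content (n : ℕ) (m : ℕ →₀ ℕ) : {s : Fin n → ℕ | content s = m}.Finite := by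
  refine (Set.Finite.pi' fun _ : Fin n => m.support.finite_toSet).subset ?_
  rintro s rfl j
  rw [Finset.mem_coe, Finsupp.mem_support_iff, content, Finsupp.finsetSum_apply]
  intro h
  have := (Finset.sum_eq_zero_iff.1 h) j (Finset.mem_univ j)
  simp at this

theorem fundQuasi_apply (n : ℕ) (D : Set ℕ) (m : ℕ →₀ ℕ) :
    fundQuasi n D m = Nat.card {s : Fin n → ℕ // Compatible n D s ∧ content s = m} := by
  rw [fundQuasi]
  simp only [Compatible, content, and_assoc]

/-- Standardization matches semistandard tableaux with pairs of a standard tableau and a compatible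
sequence, preserving the content. -/
theorem schur_eq_sum (hn : μ.card = n) :
    schur μ = ∑ p : StdTab μ n, fundQuasi n p.descents := by
  funext m
  refine Eq.trans ?_ (map_sum (MvPowerSeries.coeff (R := ℤ) m)
    (fun p : StdTab μ n => fundQuasi n p.descents) Finset.univ).symm
  simp only [show ∀ F : MvPowerSeries ℕ ℤ, MvPowerSeries.coeff m F = F m from fun _ => rfl]
  simp only [fundQuasi_apply]
  rw [schur, ← Nat.cast_sum, Nat.cast_inj]
  have : ∀ p : StdTab μ n,
      Finite {s : Fin n → ℕ // Compatible n p.descents s ∧ content s = m} :=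
    fun p => ((finite_content n m).subset fun s hs => hs.2).to_subtype
  rw [← Nat.card_sigma]
  symm
  refine Nat.card_congr (Equiv.ofBijective (fun x => ⟨x.1.toSSYT x.2.1 x.2.2.1,
    (x.1.sum_toSSYT x.2.1 x.2.2.1).trans x.2.2.2⟩) ⟨?_, ?_⟩)
  · rintro ⟨p, s, hs, hm⟩ ⟨p', s', hs', hm'⟩ h
    obtain ⟨rfl, rfl⟩ := StdTab.toSSYT_injective p p' s s' hs hs' (Subtype.ext_iff.1 h)
    rfl
  · rintro ⟨T, hT⟩
    obtain ⟨p, s, hs, rfl⟩ := StdTab.exists_toSSYT hn T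
    exact ⟨⟨p, s, hs, (p.sum_toSSYT s hs).symm.trans hT⟩, rfl⟩

/-! ### Coefficients of fundamental quasisymmetric functions -/

theorem toMultiset_content {n : ℕ} (s : Fin n → ℕ) :
    Finsupp.toMultiset (content s) = (List.ofFn s : Multiset ℕ) := by
  rw [content, map_sum, ← Fin.univ_val_map]
  simp only [Finsupp.toMultiset_single, one_smul]
  exact (congrArg Multiset.sum (Multiset.map_map _ _ _)).symm.trans (Multiset.sum_map_singleton _)

theorem eq_of_content_eq {n : ℕ} {s s' : Fin n → ℕ} (hs : Monotone s) (hs' : Monotone s')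
    (h : content s = content s') : s = s' := by
  have := congrArg Finsupp.toMultiset h
  rw [toMultiset_content, toMultiset_content, Multiset.coe_eq_coe] at this
  exact List.ofFn_injective (this.eq_of_sortedLE hs.sortedLE_ofFn hs'.sortedLE_ofFn)

theorem content_ne {n n' : ℕ} (h : n ≠ n') (s : Fin n → ℕ) (s' : Fin n' → ℕ) :
    content s ≠ content s' := by
  intro e
  have := congrArg (fun m => Multiset.card (Finsupp.toMultiset m)) e
  simp only [toMultiset_content, Multiset.coe_card, List.length_ofFn] at this
  exact h this

/-- The weakly increasing sequence starting at `0` that increases by `1` at the positions in `E`. -/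
def stair (n : ℕ) (E : Finset ℕ) (j : Fin n) : ℕ := (E.filter (· < (j : ℕ))).card

theorem stair_monotone (n : ℕ) (E : Finset ℕ) : Monotone (stair n E) := fun _ _ hij =>
  Finset.card_le_card (Finset.monotone_filter_right _ fun _ _ h => lt_of_lt_of_le h hij)

theorem stair_lt_iff {n : ℕ} {E : Finset ℕ} {j : ℕ} (h : j + 1 < n) :
    stair n E ⟨j, Nat.lt_of_succ_lt h⟩ < stair n E ⟨j + 1, h⟩ ↔ j ∈ E := by
  rw [stair, stair]
  by_cases hj : j ∈ E
  · have : E.filter (· < j + 1) = insert j (E.filter (· < j)) := by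
      ext x
      simp only [Finset.mem_filter, Finset.mem_insert]
      constructor
      · intro hx
        by_cases e : x = j
        · exact Or.inl e
        · exact Or.inr ⟨hx.1, by omega⟩
      · rintro (rfl | hx)
        · exact ⟨hj, by omega⟩
        · exact ⟨hx.1, by omega⟩
    simp only [this]
    rw [Finset.card_insert_of_notMem (by simp)]
    simp [hj]
  · have : E.filter (· < j + 1) = E.filter (· < j) := by
      ext x
      simp only [Finset.mem_filter]
      refine and_congr_right fun hx => ?_
      have : x ≠ j := fun e => hj (e ▸ hx)
      omega
    simp only [this, lt_irrefl, hj]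

-- A weakly increasing sequence is determined by its content, so the only candidate is `stair n E`
-- itself, whose strict increases are at the positions in `E`.
open Classical in
theorem fundQuasi_stair (n : ℕ) (D : Set ℕ) (E : Finset ℕ) :
    fundQuasi n D (content (stair n E)) = if ∀ j ∈ D, j + 1 < n → j ∈ E then 1 else 0 := by
  rw [fundQuasi_apply]
  split_ifs with h
  · have : Unique {s : Fin n → ℕ // Compatible n D s ∧ content s = content (stair n E)} :=
      { default := ⟨stair n E,
          ⟨stair_monotone n E, fun j hj hD => (stair_lt_iff hj).2 (h j hD hj)⟩, rfl⟩
        uniq := fun s => Subtype.ext (eq_of_content_eq s.2.1.1 (stair_monotone n E) s.2.2) }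
    rw [Nat.card_unique, Nat.cast_one]
  · have : IsEmpty {s : Fin n → ℕ // Compatible n D s ∧ content s = content (stair n E)} := by
      refine ⟨fun s => h fun j hD hj => ?_⟩
      have e := eq_of_content_eq s.2.1.1 (stair_monotone n E) s.2.2
      rw [← stair_lt_iff hj, ← e]
      exact s.2.1.2 j hj hD
    rw [Nat.card_of_isEmpty, Nat.cast_zero]

theorem fundQuasi_stair_of_ne {n n' : ℕ} (h : n' ≠ n) (D : Set ℕ) (E : Finset ℕ) :
    fundQuasi n' D (content (stair n E)) = 0 := by
  rw [fundQuasi_apply]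
  have : IsEmpty {s : Fin n' → ℕ // Compatible n' D s ∧ content s = content (stair n E)} :=
    ⟨fun s => content_ne h _ _ s.2.2⟩
  rw [Nat.card_of_isEmpty, Nat.cast_zero]

/-- A linear functional that takes the coefficient of `fundQuasi n D`. -/
def fundCoeff (n : ℕ) (D : Finset ℕ) : MvPowerSeries ℕ ℤ →ₗ[ℤ] ℤ :=
  ∑ E ∈ D.powerset, (-1 : ℤ) ^ (D \ E).card • MvPowerSeries.coeff (content (stair n E))

theorem fundCoeff_apply (n : ℕ) (D : Finset ℕ) (F : MvPowerSeries ℕ ℤ) : fundCoeff n D F =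
    ∑ E ∈ D.powerset, (-1 : ℤ) ^ (D \ E).card * F (content (stair n E)) := by
  rw [fundCoeff, LinearMap.sum_apply]
  rfl

-- By `fundQuasi_stair` the coefficients record containment of descent sets; Möbius inversion over
-- the subsets of `D` isolates equality.
open Classical in
theorem fundCoeff_fundQuasi {n : ℕ} {D : Finset ℕ} (hD : ∀ j ∈ D, j + 1 < n) (C : Set ℕ) :
    fundCoeff n D (fundQuasi n C) =
      if (∀ j, j ∈ D ↔ j ∈ C ∧ j + 1 < n) then 1 else 0 := by
  simp only [fundCoeff_apply, fundQuasi_stair]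
  by_cases h : ∀ j ∈ C, j + 1 < n → j ∈ D
  -- Expanded over subsets of `D`, this product gives the alternating sum; its factor at `i` is 1
  -- for `i ∈ C` and 0 otherwise.
  · have e := Finset.prod_add (fun _ => (1 : ℤ)) (fun i => if i ∉ C then -1 else 0) D
    have e2 : ∀ i, (1 + if i ∉ C then -1 else 0 : ℤ) = if i ∈ C then 1 else 0 := by
      intro i
      by_cases hi : i ∈ C <;> simp [hi]
    simp only [e2, Finset.prod_const_one, one_mul, Finset.prod_ite_zero, Finset.prod_const] at e
    have e1 : ∀ E ∈ D.powerset, ((-1 : ℤ) ^ (D \ E).card *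
        if ∀ j ∈ C, j + 1 < n → j ∈ E then 1 else 0) =
        if ∀ i ∈ D \ E, i ∉ C then (-1) ^ (D \ E).card else 0 := by
      intro E _
      rw [mul_ite, mul_one, mul_zero]
      refine if_congr ⟨fun h' i hi hC => ?_, fun h' j hj hn => ?_⟩ rfl rfl
      · rw [Finset.mem_sdiff] at hi
        exact hi.2 (h' i hC (hD i hi.1))
      · by_contra hE
        exact h' j (Finset.mem_sdiff.2 ⟨h j hj hn, hE⟩) hj
    rw [Finset.sum_congr rfl e1, ← e]
    exact if_congr ⟨fun h' j => ⟨fun hj => ⟨h' j hj, hD j hj⟩, fun hj => h j hj.1 hj.2⟩,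
      fun h' j hj => ((h' j).1 hj).1⟩ rfl rfl
  · rw [if_neg fun h' => h fun j hj hn => (h' j).2 ⟨hj, hn⟩]
    refine Finset.sum_eq_zero fun E hE => ?_
    rw [if_neg, mul_zero]
    exact fun h' => h fun j hj hn => Finset.mem_powerset.1 hE (h' j hj hn)

theorem fundCoeff_fundQuasi_of_ne {n n' : ℕ} (h : n' ≠ n) (D : Finset ℕ) (C : Set ℕ) :
    fundCoeff n D (fundQuasi n' C) = 0 := by
  rw [fundCoeff_apply]
  exact Finset.sum_eq_zero fun E _ => by rw [fundQuasi_stair_of_ne h, mul_zero]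

/-! ### A functional that is nonnegative on Schur functions -/

/-- The positions `0, …, 6` other than the one after the first `d` letters. -/
def allBut (d : ℕ) : Finset ℕ := (Finset.range 7).filter fun j => j + 1 ≠ d

/-- The pairing with `e_4 e_4 - e_5 e_3`, as a combination of coefficients. -/
def pairing2222 : MvPowerSeries ℕ ℤ →ₗ[ℤ] ℤ := fundCoeff 8 (allBut 4) - fundCoeff 8 (allBut 5)

open Classical in
theorem fundCoeff_allBut {d : ℕ} (hd : d = 4 ∨ d = 5) (C : Set ℕ) :
    fundCoeff 8 (allBut d) (fundQuasi 8 C) = (if ∀ j < 7, j + 1 ≠ d → j ∈ C then 1 else 0) -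
      if ∀ j < 7, j ∈ C then 1 else 0 := by
  have hm : ∀ j, j ∈ allBut d ↔ j < 7 ∧ j + 1 ≠ d := fun j => by
    rw [allBut, Finset.mem_filter, Finset.mem_range]
  have hd' : d - 1 < 7 := by omega
  rw [fundCoeff_fundQuasi fun j hj => by have := ((hm j).1 hj).1; omega]
  simp only [hm]
  by_cases h1 : ∀ j < 7, j ∈ C
  · rw [if_pos h1, if_pos fun j hj _ => h1 j hj, if_neg, sub_self]
    intro h
    have := (h (d - 1)).2 ⟨h1 _ hd', by omega⟩
    omega
  · rw [if_neg h1, sub_zero]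
    have key : (∀ j < 7, j + 1 ≠ d → j ∈ C) → ∀ j, j < 7 ∧ j + 1 ≠ d ↔ j ∈ C ∧ j + 1 < 8 := by
      refine fun h j => ⟨fun hj => ⟨h j hj.1 hj.2, by omega⟩, ?_⟩
      rintro ⟨hj, hj'⟩
      refine ⟨by omega, fun e => h1 fun i hi => ?_⟩
      by_cases e' : i + 1 = d
      · obtain rfl : i = j := by omega
        exact hj
      · exact h i hi e'
    split_ifs with h h' h'
    · rfl
    · exact (h' fun j hj hjd => ((h j).1 ⟨hj, hjd⟩).1).elim
    · exact (h (key h')).elim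
    · rfl

open Classical in
theorem pairing2222_fundQuasi (C : Set ℕ) : pairing2222 (fundQuasi 8 C) =
    (if ∀ j < 7, j + 1 ≠ 4 → j ∈ C then 1 else 0) -
      if ∀ j < 7, j + 1 ≠ 5 → j ∈ C then 1 else 0 := by
  -- The terms for the full descent set, subtracted in both coefficients, cancel.
  rw [pairing2222, LinearMap.sub_apply, fundCoeff_allBut (Or.inl rfl), fundCoeff_allBut (Or.inr rfl),
    sub_sub_sub_cancel_right]
  congr!

theorem pairing2222_fundQuasi_of_ne {n : ℕ} (h : n ≠ 8) (C : Set ℕ) :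
    pairing2222 (fundQuasi n C) = 0 := by
  rw [pairing2222, LinearMap.sub_apply, fundCoeff_fundQuasi_of_ne h, fundCoeff_fundQuasi_of_ne h,
    sub_self]

/-- The cells of the tableaux with all descents except perhaps the fifth, in order. -/
def decrCells : Fin 4 → Fin 8 → ℕ × ℕ :=
  ![![(0, 0), (1, 0), (2, 0), (3, 0), (4, 0), (5, 0), (6, 0), (7, 0)],
    ![(0, 0), (1, 0), (2, 0), (3, 0), (4, 0), (0, 1), (5, 0), (6, 0)],
    ![(0, 0), (1, 0), (2, 0), (3, 0), (4, 0), (0, 1), (1, 1), (5, 0)],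
    ![(0, 0), (1, 0), (2, 0), (3, 0), (4, 0), (0, 1), (1, 1), (2, 1)]]

/-- Move the fifth entry behind the following `k` ones. -/
def moveFifth : Fin 4 → Fin 8 → Fin 8 :=
  ![![0, 1, 2, 3, 4, 5, 6, 7], ![0, 1, 2, 3, 5, 4, 6, 7], ![0, 1, 2, 3, 5, 6, 4, 7],
    ![0, 1, 2, 3, 5, 6, 7, 4]]

theorem forall_fin_eight {P : Fin 8 → Prop} :
    (∀ i, P i) ↔ P 0 ∧ P 1 ∧ P 2 ∧ P 3 ∧ P 4 ∧ P 5 ∧ P 6 ∧ P 7 :=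
  ⟨fun h => ⟨h 0, h 1, h 2, h 3, h 4, h 5, h 6, h 7⟩,
    fun ⟨_, _, _, _, _, _, _, _⟩ i => by fin_cases i <;> assumption⟩

/-- In an enumeration of a Young diagram, the next cell in a column is the first one that is not
yet enumerated. -/
theorem next_in_column {q : Fin 8 → ℕ × ℕ} (H : ∀ j, ∀ z ≤ q j, ∃ i ≤ j, q i = z)
    (inj : Function.Injective q) (j : Fin 8) (m : ℕ) {c : ℕ} (hc : (q j).2 = c)
    (h1 : ∀ i < j, (q i).2 = c → (q i).1 < m) (h2 : ∀ r < m, ∃ i < j, q i = (r, c)) :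
    q j = (m, c) := by
  rcases lt_trichotomy (q j).1 m with h | h | h
  · obtain ⟨i, hi, e⟩ := h2 _ h
    exact absurd (inj (e.trans (Prod.ext rfl hc.symm))) hi.ne
  · exact Prod.ext h hc
  · obtain ⟨i, hi, e⟩ := H j (m, c) ⟨h.le, hc.ge⟩
    rcases hi.lt_or_eq with hi | rfl
    · have := h1 i hi (by rw [e])
      rw [e] at this
      exact absurd this (lt_irrefl m)
    · rw [e] at h
      exact absurd h (lt_irrefl m)

/-- The columns of the first five cells weakly decrease from 0, so these cells fill the top of the
first column. The last three columns weakly decrease from at most 1, and the four cases are the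
number of cells put in the second column. -/
theorem exists_eq_decrCells {q : Fin 8 → ℕ × ℕ} (H : ∀ j, ∀ z ≤ q j, ∃ i ≤ j, q i = z)
    (inj : Function.Injective q)
    (D : ∀ j : Fin 7, j ≠ 4 → (q j.succ).2 ≤ (q j.castSucc).2) : ∃ k, q = decrCells k := by
  have q0 : q 0 = (0, 0) := by
    obtain ⟨i, hi, e⟩ := H 0 (0, 0) ⟨Nat.zero_le _, Nat.zero_le _⟩
    rwa [Fin.le_zero_iff.1 hi] at e
  have d0 : (q 1).2 ≤ (q 0).2 := D 0 (by decide)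
  have d1 : (q 2).2 ≤ (q 1).2 := D 1 (by decide)
  have d2 : (q 3).2 ≤ (q 2).2 := D 2 (by decide)
  have d3 : (q 4).2 ≤ (q 3).2 := D 3 (by decide)
  have d5 : (q 6).2 ≤ (q 5).2 := D 5 (by decide)
  have d6 : (q 7).2 ≤ (q 6).2 := D 6 (by decide)
  rw [q0] at d0
  have next := next_in_column H inj
  have hcol : ∀ j : Fin 8, j ≤ 4 → (q j).2 = 0 := by
    have h0 : (q 0).2 = 0 := by rw [q0]
    have h1 : (q 1).2 = 0 := Nat.le_zero.1 d0
    have h2 : (q 2).2 = 0 := Nat.le_zero.1 (h1 ▸ d1)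
    have h3 : (q 3).2 = 0 := Nat.le_zero.1 (h2 ▸ d2)
    have h4 : (q 4).2 = 0 := Nat.le_zero.1 (h3 ▸ d3)
    rw [forall_fin_eight]
    exact ⟨fun _ => h0, fun _ => h1, fun _ => h2, fun _ => h3, fun _ => h4,
      fun h => absurd h (by decide), fun h => absurd h (by decide), fun h => absurd h (by decide)⟩
  have hq : ∀ j : Fin 8, j ≤ 4 → q j = (j.val, 0) := by
    intro j
    induction j using WellFoundedLT.induction with
    | ind j ih =>
      intro hj
      refine next j j.val (hcol j hj) (fun i hi _ => ?_) fun r hr => ?_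
      · rw [ih i hi (hi.le.trans hj)]
        exact hi
      · have hr' : (⟨r, by omega⟩ : Fin 8) < j := hr
        exact ⟨⟨r, by omega⟩, hr', ih _ hr' (hr'.le.trans hj)⟩
  have q1 : q 1 = (1, 0) := hq 1 (by decide)
  have q2 : q 2 = (2, 0) := hq 2 (by decide)
  have q3 : q 3 = (3, 0) := hq 3 (by decide)
  have q4 : q 4 = (4, 0) := hq 4 (by decide)
  have hr5 : ∀ j, 4 < j → ∀ r < 5, ∃ i < j, q i = (r, 0) := by
    intro j hj r hr
    have h4 : (⟨r, by omega⟩ : Fin 8) ≤ 4 := by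
      rw [Fin.le_def]
      exact Nat.le_of_lt_succ hr
    exact ⟨_, h4.trans_lt hj, hq _ h4⟩
  have hr6 : ∀ i j, 4 < i → i < j → q i = (5, 0) → ∀ r < 6, ∃ i < j, q i = (r, 0) := by
    intro i j hi hij e r hr
    rcases Nat.lt_succ_iff_lt_or_eq.1 hr with hr | rfl
    · exact hr5 j (hi.trans hij) r hr
    · exact ⟨i, hij, e⟩
  -- A column beyond 1 would require the cell `(0, 1)` among the first five.
  have h5 : (q 5).2 ≤ 1 := by
    by_contra h
    obtain ⟨i, hi, e⟩ := H 5 (0, 1) ⟨Nat.zero_le _, (not_le.1 h).le⟩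
    have : (q i).2 = 1 := by rw [e]
    rcases hi.lt_or_eq with hi | rfl
    · rw [hcol i (Fin.le_def.2 (Nat.le_of_lt_succ hi))] at this
      omega
    · omega
  rcases Nat.le_one_iff_eq_zero_or_eq_one.1 h5 with c5 | c5
  · have q5 : q 5 = (5, 0) := next 5 5 c5
      (by simp [forall_fin_eight, q0, q1, q2, q3, q4]) (hr5 5 (by decide))
    have q6 : q 6 = (6, 0) := next 6 6 (by omega)
      (by simp [forall_fin_eight, q0, q1, q2, q3, q4, q5]) (hr6 5 6 (by decide) (by decide) q5)
    have q7 : q 7 = (7, 0) := next 7 7 (by omega)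
      (by simp [forall_fin_eight, q0, q1, q2, q3, q4, q5, q6]) fun r hr => by
        rcases Nat.lt_succ_iff_lt_or_eq.1 hr with hr | rfl
        · exact hr6 5 7 (by decide) (by decide) q5 r hr
        · exact ⟨6, by decide, q6⟩
    exact ⟨0, funext (forall_fin_eight.2 ⟨q0, q1, q2, q3, q4, q5, q6, q7⟩)⟩
  have q5 : q 5 = (0, 1) := next 5 0 c5 (by simp [forall_fin_eight, q0, q1, q2, q3, q4]) (by simp)
  rw [c5] at d5
  rcases Nat.le_one_iff_eq_zero_or_eq_one.1 d5 with c6 | c6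
  · have q6 : q 6 = (5, 0) := next 6 5 c6
      (by simp [forall_fin_eight, q0, q1, q2, q3, q4, q5]) (hr5 6 (by decide))
    have q7 : q 7 = (6, 0) := next 7 6 (by omega)
      (by simp [forall_fin_eight, q0, q1, q2, q3, q4, q5, q6])
      (hr6 6 7 (by decide) (by decide) q6)
    exact ⟨1, funext (forall_fin_eight.2 ⟨q0, q1, q2, q3, q4, q5, q6, q7⟩)⟩
  have q6 : q 6 = (1, 1) := next 6 1 c6 (by simp [forall_fin_eight, q0, q1, q2, q3, q4, q5])
    fun r hr => ⟨5, by decide, by rw [q5, Nat.lt_one_iff.1 hr]⟩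
  rw [c6] at d6
  rcases Nat.le_one_iff_eq_zero_or_eq_one.1 d6 with c7 | c7
  · have q7 : q 7 = (5, 0) := next 7 5 c7
      (by simp [forall_fin_eight, q0, q1, q2, q3, q4, q5, q6]) (hr5 7 (by decide))
    exact ⟨2, funext (forall_fin_eight.2 ⟨q0, q1, q2, q3, q4, q5, q6, q7⟩)⟩
  · have q7 : q 7 = (2, 1) := next 7 2 c7
      (by simp [forall_fin_eight, q0, q1, q2, q3, q4, q5, q6]) fun r hr => by
        interval_cases r
        exacts [⟨5, by decide, q5⟩, ⟨6, by decide, q6⟩]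
    exact ⟨3, funext (forall_fin_eight.2 ⟨q0, q1, q2, q3, q4, q5, q6, q7⟩)⟩

variable {μ : YoungDiagram}

/-- All positions `0, …, 6` are descents, except perhaps the one after the first `d` letters. -/
def StdTab.DecrExcept (d : ℕ) (p : StdTab μ 8) : Prop := ∀ j < 7, j + 1 ≠ d → j ∈ p.descents

theorem StdTab.exists_eq_decrCells (p : StdTab μ 8) (hp : p.DecrExcept 5) :
    ∃ k, (fun j => (p.1 j).1) = decrCells k := by
  refine DZero.exists_eq_decrCells ?_ (Subtype.val_injective.comp p.1.injective) ?_
  · intro j z hz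
    have hzμ : z ∈ μ := μ.up_left_mem hz.1 hz.2 (p.1 j).2
    obtain ⟨i, hi⟩ := p.1.surjective ⟨z, hzμ⟩
    have e : (p.1 i).1 = z := by rw [hi]
    exact ⟨i, p.2 i j (e.le.trans hz), e⟩
  · intro j hj
    obtain ⟨_, h⟩ := hp j j.isLt (by
      intro e
      exact hj (Fin.ext (Nat.succ_injective e)))
    exact h

/-- Postponing the cell `(4, 0)` until after the cells in the second column moves the possible
nondescent one place earlier: the step to the right now starts at `(3, 0)`. -/
theorem StdTab.exists_decrExcept_four (p : StdTab μ 8) (hp : p.DecrExcept 5) :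
    ∃ p' : StdTab μ 8, p'.DecrExcept 4 := by
  obtain ⟨k, hk⟩ := p.exists_eq_decrCells hp
  have hk' : ∀ j, (p.1 j).1 = decrCells k j := congrFun hk
  have hbij : ∀ k, Function.Bijective (moveFifth k) := by decide
  have hle : ∀ k i j, decrCells k (moveFifth k i) ≤ decrCells k (moveFifth k j) → i ≤ j := by
    decide
  have hdes : ∀ k, ∀ j : Fin 7, j ≠ 3 → (decrCells k (moveFifth k j.succ)).2 ≤
      (decrCells k (moveFifth k j.castSucc)).2 := by decide
  refine ⟨⟨(Equiv.ofBijective _ (hbij k)).trans p.1, fun i j h => hle k i j ?_⟩, ?_⟩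
  · simpa [hk'] using h
  · intro j hj hj4
    refine ⟨by omega, ?_⟩
    have := hdes k ⟨j, hj⟩ (by
      intro e
      exact hj4 (congrArg (fun i : Fin 7 => i.val + 1) e))
    simpa [hk'] using this

/-- The four enumerations in `decrCells` fill four different shapes. -/
theorem StdTab.eq_of_decrExcept_five (p p' : StdTab μ 8) (hp : p.DecrExcept 5)
    (hp' : p'.DecrExcept 5) : p = p' := by
  obtain ⟨k, hk⟩ := p.exists_eq_decrCells hp
  obtain ⟨k', hk'⟩ := p'.exists_eq_decrCells hp'
  have himage : ∀ p : StdTab μ 8, Finset.univ.image (fun j => (p.1 j).1) = μ.cells := by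
    intro p
    ext z
    simp only [Finset.mem_image, Finset.mem_univ, true_and]
    constructor
    · rintro ⟨j, rfl⟩
      exact (p.1 j).2
    · intro hz
      obtain ⟨j, hj⟩ := p.1.surjective ⟨z, hz⟩
      exact ⟨j, by rw [hj]⟩
  have e := (himage p).trans (himage p').symm
  rw [hk, hk'] at e
  have hinj : ∀ k k', Finset.univ.image (decrCells k) = Finset.univ.image (decrCells k') →
      k = k' := by decide
  obtain rfl := hinj k k' e
  exact Subtype.ext (Equiv.ext fun j => Subtype.ext (congrFun (hk.trans hk'.symm) j))

/-- In degree 8 the functional is a difference of two numbers of tableaux. The subtracted number is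
at most 1, and when it is 1 the other is positive. In other degrees the functional vanishes. -/
theorem pairing2222_schur (μ : YoungDiagram) : 0 ≤ pairing2222 (schur μ) := by
  classical
  by_cases hμ : μ.card = 8
  · rw [schur_eq_sum hμ, map_sum]
    simp only [pairing2222_fundQuasi]
    rw [Finset.sum_sub_distrib, Finset.sum_boole, Finset.sum_boole, sub_nonneg, Nat.cast_le]
    rcases (Finset.univ.filter fun p : StdTab μ 8 =>
      ∀ j < 7, j + 1 ≠ 5 → j ∈ p.descents).eq_empty_or_nonempty with h | h
    · exact (Finset.card_eq_zero.2 h).le.trans (Nat.zero_le _)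
    · obtain ⟨p, hp⟩ := h
      obtain ⟨p', hp'⟩ := p.exists_decrExcept_four (Finset.mem_filter.1 hp).2
      refine (Finset.card_le_one.2 fun a ha b hb => ?_).trans
        (Finset.card_pos.2 ⟨p', Finset.mem_filter.2 ⟨Finset.mem_univ _, hp'⟩⟩)
      exact a.eq_of_decrExcept_five b (Finset.mem_filter.1 ha).2 (Finset.mem_filter.1 hb).2
  · rw [schur_eq_sum rfl, map_sum]
    exact (Finset.sum_eq_zero fun p _ => pairing2222_fundQuasi_of_ne hμ _).ge

theorem pairing2222_nonneg {F : MvPowerSeries ℕ ℤ} (hF : SchurPositive F) : 0 ≤ pairing2222 F := by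
  obtain ⟨c, rfl⟩ := hF
  rw [Finsupp.sum, map_sum]
  refine Finset.sum_nonneg fun μ _ => ?_
  rw [map_smul]
  exact mul_nonneg (Int.natCast_nonneg _) (pairing2222_schur μ)

theorem pairing2222_Wbar : pairing2222 (∑ w ∈ Wbar, fundQuasi 8 (descents w)) = -1 := by
  classical
  have h : ∀ d, ∀ w ∈ Wbar, (∀ j < 7, j + 1 ≠ d → j ∈ descents w) ↔ DecrExcept d w := by
    intro d w hw
    have hlen := (mem_Wbar hw).1
    exact ⟨fun h j hj hd => (h j (by omega) hd).2, fun h j hj hd => ⟨by omega, h j (by omega) hd⟩⟩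
  rw [map_sum]
  simp only [pairing2222_fundQuasi]
  rw [Finset.sum_sub_distrib, Finset.sum_boole, Finset.sum_boole,
    Finset.filter_congr (h 4), Finset.filter_congr (h 5)]
  have h4 := card_Wbar_filter 4
  have h5 := card_Wbar_filter 5
  rw [countAcc_decr4] at h4
  rw [countAcc_decr5] at h5
  have h4' : (Wbar.filter (DecrExcept 4)).card = 51 := by convert h4
  have h5' : (Wbar.filter (DecrExcept 5)).card = 52 := by convert h5
  rw [h4', h5']
  norm_num

theorem Delta_fstar : Delta 8 fstar = ∑ w ∈ Wbar, fundQuasi 8 (descents w) := by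
  rw [fstar, wordSum, map_sum]
  refine Finset.sum_congr rfl fun w hw => ?_
  have e : Delta 8 (mono w) = fundQuasi w.length (descents w) := by
    show Finsupp.linearCombination ℤ _ (Finsupp.single (FreeMonoid.ofList w) (1 : ℤ)) = _
    rw [Finsupp.linearCombination_single, one_smul]
    rfl
  rw [e, (mem_Wbar hw).1]

end DZero

end

theorem corollaryc :
    DZero.fstar ∈ DZero.perp (DZero.idealKR 8) ∧
    DZero.pairing (DZero.ncSchur 8 DZero.shape2222) DZero.fstar = -1 ∧
    ¬ DZero.SchurPositive (DZero.Delta 8 DZero.fstar) ∧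
    ∃ G : DZero.D0Graph 8 8, G.verts = DZero.Wbar ∧ ¬ DZero.SchurPositive G.genFun := by
  have hneg : ¬ DZero.SchurPositive (∑ w ∈ DZero.Wbar, DZero.fundQuasi 8 (DZero.descents w)) := by
    intro h
    have := DZero.pairing2222_nonneg h
    rw [DZero.pairing2222_Wbar] at this
    omega
  refine ⟨DZero.wordSum_mem_perp (fun w hw => (DZero.mem_Wbar hw).2) DZero.balanced_Wbar,
    DZero.pairing_ncSchur_fstar, DZero.Delta_fstar ▸ hneg, ?_⟩
  obtain ⟨G, hG⟩ := DZero.exists_D0Graph (n := 8) (fun w hw => DZero.mem_Wbar hw)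
    DZero.balanced_Wbar
  refine ⟨G, hG, ?_⟩
  rw [DZero.D0Graph.genFun, hG]
  exact hneg
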